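/- Let $K\in\mathbb N$ be fixed and let $p=p(n)$ satisfy $p/n\to c\in(0,\infty)$ as $n\to\infty$. For each $n$ and $r\in\{1,\dots,K\}$ let $A_n^{(r)}\in\mathbb C^{p\times p}$ and $B_n^{(r)}\in\mathbb C^{n\times n}$ be non-random positive semidefinite matrices such that, for some $\tau>0$, $\|A_n^{(r)}\|_{op}\le\tau$ and $\|B_n^{(r)}\|_{op}\le\tau$ for all $n$ and $r$. For $\mathbf Z=(Z^{(1)},\dots,Z^{(K)})$ with $Z^{(r)}\in\mathbb C^{p\times n}$, put $$X_n(\mathbf Z)=\sum_{r=1}^K (A_n^{(r)})^{1/2}Z^{(r)}(B_n^{(r)})^{1/2},\qquad \mathcal S_n(\mathbf Z)=\frac1n X_n(\mathbf Z)X_n(\mathbf Z)^*,$$ and for $z\in\mathbb C_+=\{z:\Im z>0\}$ let $f_n(\mathbf Z;z)=\frac1p\operatorname{trace}\big((\mathcal S_n(\mathbf Z)-zI_p)^{-1}\big)$, the Stieltjes transform of the empirical spectral distribution of $\mathcal S_n(\mathbf Z)$. For each $n$, let $\mathbf Z_n=(Z_n^{(1)},\dots,Z_n^{(K)})$ be random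 complex $p\times n$ matrices, all of whose entries $z_{ij}^{(r)}$ are independent with $\mathbb E z_{ij}^{(r)}=0$ and $\mathbb E|z_{ij}^{(r)}|^2=1$, and let $\mathbf W_n=(W_n^{(1)},\dots,W_n^{(K)})$ be random complex $p\times n$ matrices whose entries are i.i.d. standard complex Gaussian (independent real and imaginary parts, each $N(0,1/2)$). Let $\eta_0>0$ and $\frac1{4+\eta_0}<a<\frac14$. Write $\hat{\mathbf Z}_n$ and $\hat{\mathbf W}_n$ for the matrices obtained by replacing every entry of modulus larger than $n^a$ by $0$. Then for every $z\in\mathbb C_+$ the following hold. 1. If $\sup_{n,r,i,j}\mathbb E|z_{ij}^{(r)}|^{4+\eta_0}<\infty$, then, as $n\to\infty$, $$\big|\mathbb E f_n(\hat{\mathbf W}_n;z)-\mathbb E f_n(\hat{\mathbf Z}_n;z)\big|\to0\quad\text{and}\quad \big|\mathbb E f_n(\mathbf W_n;z)-\mathbb E f_n(\hat{\mathbf Z}_n;z)\big|\to0 .$$ 2. If $|z_{ij}^{(r)}|\le n^a$ almost surely for all $n,r,i,j$, then, as $n\to\infty$, $$\big|\mathbb E f_n(\hat{\mathbf W}_n;z)-\mathbb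 E f_n(\mathbf Z_n;z)\big|\to0\quad\text{and}\quad \big|\mathbb E f_n(\mathbf W_n;z)-\mathbb E f_n(\mathbf Z_n;z)\big|\to0 .$$ -/

import Mathlib

open MeasureTheory ProbabilityTheory Filter Topology
open scoped MatrixOrder ComplexOrder

noncomputable section

/-- Spectral (operator) norm of a square complex matrix, acting on Euclidean space. -/
def opNorm {m : ℕ} (A : Matrix (Fin m) (Fin m) ℂ) : ℝ :=
  ‖Matrix.toEuclideanCLM (n := Fin m) (𝕜 := ℂ) A‖

/-- `X = ∑ r, (A r)^{1/2} Z r (B r)^{1/2}`, with positive semidefinite square roots. -/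
def dataMatrix {K p n : ℕ} (A : Fin K → Matrix (Fin p) (Fin p) ℂ)
    (B : Fin K → Matrix (Fin n) (Fin n) ℂ) (Z : Fin K → Matrix (Fin p) (Fin n) ℂ) :
    Matrix (Fin p) (Fin n) ℂ :=
  ∑ r, CFC.sqrt (A r) * Z r * CFC.sqrt (B r)

/-- `(1 / n) X X*`, where `X` is the data matrix with innovations `Z`. -/
def sampleCov {K p n : ℕ} (A : Fin K → Matrix (Fin p) (Fin p) ℂ)
    (B : Fin K → Matrix (Fin n) (Fin n) ℂ) (Z : Fin K → Matrix (Fin p) (Fin n) ℂ) :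
    Matrix (Fin p) (Fin p) ℂ :=
  (1 / (n : ℂ)) • (dataMatrix A B Z * (dataMatrix A B Z).conjTranspose)

/-- The Stieltjes transform at `z` of the empirical spectral distribution of a Hermitian
matrix `S`, given as the normalized trace of the resolvent `(S - z I)⁻¹`. -/
def stieltjes {p : ℕ} (S : Matrix (Fin p) (Fin p) ℂ) (z : ℂ) : ℂ :=
  (1 / (p : ℂ)) * ((S - z • (1 : Matrix (Fin p) (Fin p) ℂ))⁻¹).trace

/-- For Hermitian `S`, `stieltjes S z` is the integral of `1 / (x - z)` against the uniform
distribution on the eigenvalues of `S`. -/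
theorem stieltjes_eq_sum {p : ℕ} {S : Matrix (Fin p) (Fin p) ℂ} (hS : S.IsHermitian)
    {z : ℂ} (hz : 0 < z.im) :
    stieltjes S z = (1 / (p : ℂ)) * ∑ i, 1 / ((hS.eigenvalues i : ℂ) - z) := by
  have hne : ∀ i, ((hS.eigenvalues i : ℂ) - z) ≠ 0 := by
    intro i h
    have := congrArg Complex.im h
    simp at this
    exact hz.ne' this
  set U := hS.eigenvectorUnitary with hU
  set φ := Unitary.conjStarAlgAut ℂ (Matrix (Fin p) (Fin p) ℂ) U with hφ
  have h1 : S - z • (1 : Matrix (Fin p) (Fin p) ℂ) =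
      φ (Matrix.diagonal fun i => (hS.eigenvalues i : ℂ) - z) := by
    have e : (Matrix.diagonal fun i => (hS.eigenvalues i : ℂ) - z) =
        Matrix.diagonal (RCLike.ofReal ∘ hS.eigenvalues) - z • (1 : Matrix (Fin p) (Fin p) ℂ) := by
      rw [← Matrix.diagonal_one, ← Matrix.diagonal_smul, Matrix.diagonal_sub]
      congr 1
      funext i
      simp
    rw [e, map_sub, map_smul, map_one, hφ, ← hS.spectral_theorem]
  have h2 : (S - z • (1 : Matrix (Fin p) (Fin p) ℂ))⁻¹ =
      φ (Matrix.diagonal fun i => 1 / ((hS.eigenvalues i : ℂ) - z)) := by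
    apply Matrix.inv_eq_right_inv
    rw [h1, ← map_mul, Matrix.diagonal_mul_diagonal]
    simp [hne]
  have h3 : ∀ D : Matrix (Fin p) (Fin p) ℂ, (φ D).trace = D.trace := by
    intro D
    rw [hφ, Unitary.conjStarAlgAut_apply, Matrix.trace_mul_cycle, Unitary.coe_star_mul_self,
      one_mul]
  rw [stieltjes, h2, h3, Matrix.trace_diagonal]

/-- Entrywise truncation: entries of modulus greater than `b` are replaced by `0`. -/
def truncate {p n : ℕ} (b : ℝ) (Z : Matrix (Fin p) (Fin n) ℂ) : Matrix (Fin p) (Fin n) ℂ :=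
  Z.map fun w => if ‖w‖ ≤ b then w else 0

/-- The standard (circularly symmetric) complex Gaussian law: independent real and imaginary
parts, each distributed as `N(0, 1/2)`. -/
def stdComplexGaussian : Measure ℂ :=
  ((gaussianReal 0 (1 / 2)).prod (gaussianReal 0 (1 / 2))).map
    fun x : ℝ × ℝ => (x.1 : ℂ) + (x.2 : ℂ) * Complex.I

end

/-! The proof is Lindeberg's replacement method. The difficulty is that `E h ^ 2` may differ between
the two families (real entries against circular Gaussian ones), so a single replacement does not
match second moments completely.

Linearization: with `w * w = z` and `0 < w.im`, the Stieltjes transform at `z` is an affine function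
of the trace of the resolvent at `w` of the Hermitian block matrix with off-diagonal blocks `X / √n`
and its adjoint (`trace_resolvMatrix_fromBlocks`, `stieltjes_sampleCov_eq`). This matrix is
real-linear in the entries, and each entry multiplies a rank-one coefficient of trace norm at most
`τ`. Iterating the resolvent identity gives a second order expansion in one entry, with remainder of
order `n ^ (-3/2) * ‖h‖ ^ 3`.

Unmatched terms: for the rank-one coefficient, the factor of `h ^ 2` is a product of two matrix
entries (`trace_mul_single_sq`). Since the squared entries in a column sum to at most the squared
operator norm, these factors sum over all `N = K * p * n` positions to `O(p + n)`, hence to `O(1)`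
after the factor `1 / n` (`sum_norm_trace_innovationCoeff_le`). The bound holds at every
configuration, so when `k` variables remain one of them has expected coefficient at most `D / k`.
Replacing that variable next makes the total cost `D * harmonic N = O(log n)`
(`norm_integral_pi_sub_le`), which vanishes after division by `p`.

Errors: after division by `p`, mean errors cost `√n * ε₁`, variance errors `ε₂`, and third moments
`L / √n`. Truncation at `n ^ a` without recentring gives `ε₁` and `ε₂` small enough because `a * (4
+ η₀) > 1` and `a < 1/4`; in the bounded case `L = n ^ a` suffices. -/

/-! ### Nearly standard laws and the exchange of a single variable -/

/-- A law on `ℂ` whose mean is at most `ε₁`, whose second absolute moment is within `ε₂` of `1`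
and whose third absolute moment is at most `L`. -/
structure IsNearStandard (μ : Measure ℂ) (ε₁ ε₂ L : ℝ) : Prop where
  integrable : Integrable (fun h : ℂ => ‖h‖ ^ 3) μ
  mean : ‖∫ h, h ∂μ‖ ≤ ε₁
  var : |∫ h, ‖h‖ ^ 2 ∂μ - 1| ≤ ε₂
  third : ∫ h, ‖h‖ ^ 3 ∂μ ≤ L

namespace IsNearStandard

variable {μ : Measure ℂ} {ε₁ ε₂ L : ℝ}

theorem integrable_norm [IsProbabilityMeasure μ] (h : IsNearStandard μ ε₁ ε₂ L) :
    Integrable (fun x : ℂ => ‖x‖) μ := by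
  refine ((integrable_const (1 : ℝ)).add h.integrable).mono' (by fun_prop) (ae_of_all _ fun x => ?_)
  simp only [norm_norm, Pi.add_apply]
  nlinarith [sq_nonneg (‖x‖ - 1), norm_nonneg x, mul_nonneg (norm_nonneg x) (sq_nonneg (‖x‖ - 1))]

theorem integrable_sq [IsProbabilityMeasure μ] (h : IsNearStandard μ ε₁ ε₂ L) :
    Integrable (fun x : ℂ => ‖x‖ ^ 2) μ := by
  refine ((integrable_const (1 : ℝ)).add h.integrable).mono' (by fun_prop) (ae_of_all _ fun x => ?_)
  simp only [norm_pow, norm_norm, Pi.add_apply]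
  nlinarith [sq_nonneg (‖x‖ - 1), norm_nonneg x, mul_nonneg (norm_nonneg x) (sq_nonneg (‖x‖ - 1))]

theorem integral_norm_le [IsProbabilityMeasure μ] (h : IsNearStandard μ ε₁ ε₂ L) :
    ∫ x, ‖x‖ ∂μ ≤ 1 + L := by
  have : ∫ x : ℂ, ‖x‖ ∂μ ≤ ∫ x : ℂ, (1 + ‖x‖ ^ 3) ∂μ := by
    refine integral_mono h.integrable_norm ((integrable_const (1 : ℝ)).add h.integrable) fun x => ?_
    simp only
    nlinarith [sq_nonneg (‖x‖ - 1), norm_nonneg x,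
      mul_nonneg (norm_nonneg x) (sq_nonneg (‖x‖ - 1))]
  rw [integral_add (integrable_const _) h.integrable] at this
  simp at this
  linarith [h.third]

theorem integral_sq_le (h : IsNearStandard μ ε₁ ε₂ L) : ∫ x, ‖x‖ ^ 2 ∂μ ≤ 1 + ε₂ := by
  linarith [(abs_le.1 h.var).2]

theorem mono {ε₁' ε₂' L' : ℝ} (h : IsNearStandard μ ε₁ ε₂ L) (h₁ : ε₁ ≤ ε₁') (h₂ : ε₂ ≤ ε₂')
    (h₃ : L ≤ L') : IsNearStandard μ ε₁' ε₂' L' :=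
  ⟨h.integrable, h.mean.trans h₁, h.var.trans h₂, h.third.trans h₃⟩

end IsNearStandard

open scoped ComplexConjugate in
/-- The integrals of a function with a second order expansion at `0` against two nearly
standard laws are close, up to the terms in `h ^ 2` and `conj h ^ 2`. -/
theorem norm_integral_sub_le_of_expansion {μ ν : Measure ℂ} [IsProbabilityMeasure μ]
    [IsProbabilityMeasure ν] {ε₁ ε₂ L : ℝ} (hμ : IsNearStandard μ ε₁ ε₂ L)
    (hν : IsNearStandard ν ε₁ ε₂ L) {φ : ℂ → ℂ} (iμ : Integrable φ μ) (iν : Integrable φ ν)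
    {c₀ α β γ δ κ : ℂ} {C : ℝ}
    (hφ : ∀ h, ‖φ h - (c₀ + h * α + conj h * β + h ^ 2 * γ + conj h ^ 2 * δ +
      ((‖h‖ ^ 2 : ℝ) : ℂ) * κ)‖ ≤ C * ‖h‖ ^ 3) :
    ‖∫ h, φ h ∂μ - ∫ h, φ h ∂ν‖ ≤ 2 * ε₁ * (‖α‖ + ‖β‖) + 2 * ε₂ * ‖κ‖ +
      2 * (1 + ε₂) * (‖γ‖ + ‖δ‖) + 2 * C * L := by
  have hC : 0 ≤ C := by simpa using (norm_nonneg _).trans (hφ 1)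
  -- Both integrals are compared with `c₀ + κ`, the value of the quadratic part for mean `0`, unit
  -- second absolute moment and vanishing `E h ^ 2`.
  have key : ∀ (ρ : Measure ℂ) [IsProbabilityMeasure ρ], IsNearStandard ρ ε₁ ε₂ L →
      Integrable φ ρ →
      ‖∫ h, φ h ∂ρ - (c₀ + κ)‖ ≤ ε₁ * (‖α‖ + ‖β‖) + ε₂ * ‖κ‖ +
        (1 + ε₂) * (‖γ‖ + ‖δ‖) + C * L := by
    intro ρ _ hρ iρ
    have i1 : Integrable (fun h : ℂ => h) ρ := (integrable_norm_iff (by fun_prop)).1 hρ.integrable_norm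
    have i1c : Integrable (fun h : ℂ => conj h) ρ :=
      (integrable_norm_iff (by fun_prop)).1 (by simpa using hρ.integrable_norm)
    have i2 : Integrable (fun h : ℂ => h ^ 2) ρ :=
      (integrable_norm_iff (by fun_prop)).1 (by simpa using hρ.integrable_sq)
    have i2c : Integrable (fun h : ℂ => conj h ^ 2) ρ :=
      (integrable_norm_iff (by fun_prop)).1 (by simpa using hρ.integrable_sq)
    have i3 : Integrable (fun h : ℂ => ((‖h‖ ^ 2 : ℝ) : ℂ)) ρ := hρ.integrable_sq.ofReal
    have j1 : Integrable (fun h : ℂ => c₀ + h * α) ρ := (integrable_const c₀).add (i1.mul_const α)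
    have j2 : Integrable (fun h : ℂ => c₀ + h * α + conj h * β) ρ := j1.add (i1c.mul_const β)
    have j3 : Integrable (fun h : ℂ => c₀ + h * α + conj h * β + h ^ 2 * γ) ρ :=
      j2.add (i2.mul_const γ)
    have j4 : Integrable (fun h : ℂ => c₀ + h * α + conj h * β + h ^ 2 * γ + conj h ^ 2 * δ) ρ :=
      j3.add (i2c.mul_const δ)
    have iq : Integrable (fun h : ℂ => c₀ + h * α + conj h * β + h ^ 2 * γ + conj h ^ 2 * δ +
        ((‖h‖ ^ 2 : ℝ) : ℂ) * κ) ρ := j4.add (i3.mul_const κ)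
    have eq : ∫ h : ℂ, (c₀ + h * α + conj h * β + h ^ 2 * γ + conj h ^ 2 * δ +
        ((‖h‖ ^ 2 : ℝ) : ℂ) * κ) ∂ρ = c₀ + (∫ h, h ∂ρ) * α + conj (∫ h, h ∂ρ) * β +
        (∫ h, h ^ 2 ∂ρ) * γ + (∫ h, conj h ^ 2 ∂ρ) * δ + ((∫ h, ‖h‖ ^ 2 ∂ρ : ℝ) : ℂ) * κ := by
      rw [integral_add j4 (i3.mul_const κ), integral_add j3 (i2c.mul_const δ),
        integral_add j2 (i2.mul_const γ), integral_add j1 (i1c.mul_const β),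
        integral_add (integrable_const c₀) (i1.mul_const α)]
      have hconj : ∫ h : ℂ, conj h ∂ρ = conj (∫ h, h ∂ρ) := integral_conj
      simp only [integral_mul_const, hconj, integral_complex_ofReal]
      simp
    -- The moments of `h ^ 2` and `conj h ^ 2` are only bounded, never matched; their coefficients
    -- must be small for another reason.
    have b2 : ‖∫ h, h ^ 2 ∂ρ‖ ≤ 1 + ε₂ :=
      (norm_integral_le_integral_norm _).trans (by simpa using hρ.integral_sq_le)
    have b2c : ‖∫ h, conj h ^ 2 ∂ρ‖ ≤ 1 + ε₂ :=
      (norm_integral_le_integral_norm _).trans (by simpa using hρ.integral_sq_le)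
    have br : ‖∫ h, φ h ∂ρ - ∫ h : ℂ, (c₀ + h * α + conj h * β + h ^ 2 * γ + conj h ^ 2 * δ +
        ((‖h‖ ^ 2 : ℝ) : ℂ) * κ) ∂ρ‖ ≤ C * L := by
      rw [← integral_sub iρ iq]
      refine (norm_integral_le_of_norm_le (hρ.integrable.const_mul C) (ae_of_all _ hφ)).trans ?_
      rw [integral_const_mul]
      exact mul_le_mul_of_nonneg_left hρ.third hC
    have hv : ‖((∫ h, ‖h‖ ^ 2 ∂ρ : ℝ) : ℂ) - 1‖ ≤ ε₂ := by
      have := hρ.var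
      rw [← Complex.ofReal_one, ← Complex.ofReal_sub, Complex.norm_real]
      exact this
    rw [eq] at br
    set m := ∫ h, h ∂ρ
    set s := ∫ h, h ^ 2 ∂ρ
    set t := ∫ h, conj h ^ 2 ∂ρ
    set v := ((∫ h, ‖h‖ ^ 2 ∂ρ : ℝ) : ℂ)
    have e : ∫ h, φ h ∂ρ - (c₀ + κ) = (∫ h, φ h ∂ρ - (c₀ + m * α + conj m * β + s * γ + t * δ +
        v * κ)) + m * α + conj m * β + s * γ + t * δ + (v - 1) * κ := by ring
    rw [e]
    have hm := hρ.mean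
    have hmc : ‖conj m‖ ≤ ε₁ := by simpa using hm
    refine (norm_add_le _ _).trans ((add_le_add ((norm_add_le _ _).trans (add_le_add
      ((norm_add_le _ _).trans (add_le_add ((norm_add_le _ _).trans (add_le_add
      ((norm_add_le _ _).trans (add_le_add br
      ((norm_mul_le _ _).trans (mul_le_mul_of_nonneg_right hm (norm_nonneg _)))))
      ((norm_mul_le _ _).trans (mul_le_mul_of_nonneg_right hmc (norm_nonneg _)))))
      ((norm_mul_le _ _).trans (mul_le_mul_of_nonneg_right b2 (norm_nonneg _)))))
      ((norm_mul_le _ _).trans (mul_le_mul_of_nonneg_right b2c (norm_nonneg _)))))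
      ((norm_mul_le _ _).trans (mul_le_mul_of_nonneg_right hv (norm_nonneg _)))).trans ?_)
    linarith
  have h1 := key μ hμ iμ
  have h2 := key ν hν iν
  have e : ∫ h, φ h ∂μ - ∫ h, φ h ∂ν = (∫ h, φ h ∂μ - (c₀ + κ)) - (∫ h, φ h ∂ν - (c₀ + κ)) := by
    ring
  rw [e]
  refine (norm_sub_le _ _).trans ((add_le_add h1 h2).trans ?_)
  linarith

/-! ### Product measures and Lindeberg replacement -/

theorem measurable_update_prod {ι X : Type*} [DecidableEq ι] [MeasurableSpace X] (q : ι) :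
    Measurable (fun x : (ι → X) × X => Function.update x.1 q x.2) := by
  refine measurable_pi_iff.2 fun i => ?_
  by_cases h : i = q
  · subst h; simpa using measurable_snd
  · simpa [h, Function.comp_def] using (measurable_pi_apply i).comp measurable_fst

/-- Resampling one coordinate of a product measure. -/
theorem map_update_pi_prod {ι X : Type*} [Fintype ι] [DecidableEq ι] [MeasurableSpace X]
    (μ : ι → Measure X) [∀ i, IsProbabilityMeasure (μ i)] (ρ : Measure X)
    [IsProbabilityMeasure ρ] (q : ι) :
    ((Measure.pi μ).prod ρ).map (fun x : (ι → X) × X => Function.update x.1 q x.2) =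
      Measure.pi (Function.update μ q ρ) := by
  have inst : ∀ i, IsProbabilityMeasure (Function.update μ q ρ i) := by
    intro i
    by_cases h : i = q
    · subst h; simpa using ‹IsProbabilityMeasure ρ›
    · simp [h]; infer_instance
  refine (Measure.pi_eq fun s hs => ?_).symm
  rw [Measure.map_apply (measurable_update_prod q) (MeasurableSet.univ_pi hs)]
  -- The overwritten coordinate is unconstrained, so its factor in the product has mass `1`.
  have e : (fun x : (ι → X) × X => Function.update x.1 q x.2) ⁻¹' Set.univ.pi s =
      (Set.univ.pi (Function.update s q Set.univ)) ×ˢ s q := by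
    ext ⟨x, h⟩
    simp only [Set.mem_preimage, Set.mem_pi, Set.mem_univ, true_imp_iff, Set.mem_prod]
    constructor
    · intro H
      refine ⟨fun i => ?_, by simpa using H q⟩
      by_cases hi : i = q
      · subst hi; simp
      · simpa [hi] using H i
    · rintro ⟨H, H'⟩ i
      by_cases hi : i = q
      · subst hi; simpa using H'
      · simpa [hi] using H i
  rw [e, Measure.prod_prod, Measure.pi_pi, ← Finset.mul_prod_erase _ _ (Finset.mem_univ q),
    ← Finset.mul_prod_erase _ _ (Finset.mem_univ q)]
  simp only [Function.update_self, measure_univ, one_mul]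
  rw [mul_comm]
  congr 1
  refine Finset.prod_congr rfl fun i hi => ?_
  simp [Finset.ne_of_mem_erase hi]

theorem integral_pi_update {ι X E : Type*} [Fintype ι] [DecidableEq ι] [MeasurableSpace X]
    [NormedAddCommGroup E] [NormedSpace ℝ E]
    (μ : ι → Measure X) [∀ i, IsProbabilityMeasure (μ i)] (ρ : Measure X)
    [IsProbabilityMeasure ρ] (q : ι) {T : (ι → X) → E} (hT : StronglyMeasurable T)
    {C : ℝ} (hC : ∀ x, ‖T x‖ ≤ C) :
    ∫ x, T x ∂Measure.pi (Function.update μ q ρ) =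
      ∫ x, ∫ h, T (Function.update x q h) ∂ρ ∂Measure.pi μ := by
  rw [← map_update_pi_prod, integral_map (measurable_update_prod q).aemeasurable
    hT.aestronglyMeasurable]
  refine integral_prod (fun x : (ι → X) × X => T (Function.update x.1 q x.2)) ?_
  exact Integrable.of_bound (hT.comp_measurable (measurable_update_prod q)).aestronglyMeasurable C
    (ae_of_all _ fun x => hC _)

open scoped ComplexConjugate in
/-- Replacing the law of one coordinate in a product measure. -/
theorem norm_integral_pi_update_sub_le {ι : Type*} [Fintype ι] [DecidableEq ι]
    {lam : ι → Measure ℂ} [∀ q, IsProbabilityMeasure (lam q)] {μ ν : Measure ℂ}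
    [IsProbabilityMeasure μ] [IsProbabilityMeasure ν] {ε₁ ε₂ L : ℝ}
    (hμ : IsNearStandard μ ε₁ ε₂ L) (hν : IsNearStandard ν ε₁ ε₂ L)
    {T : (ι → ℂ) → ℂ} (hT : Measurable T) {CT : ℝ} (hCT : ∀ x, ‖T x‖ ≤ CT)
    (q : ι) {g : (ι → ℂ) → ℝ} (hg : Measurable g) {D : ℝ} (hg0 : ∀ x, 0 ≤ g x)
    (hD : ∀ x, g x ≤ D) {C₁ C₂ C₃ : ℝ}
    (hexp : ∀ x, ∃ c₀ α β γ δ κ : ℂ, ‖α‖ + ‖β‖ ≤ C₁ ∧ ‖κ‖ ≤ C₂ ∧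
      (∀ h, ‖γ‖ + ‖δ‖ ≤ g (Function.update x q h) + C₃ * ‖h‖) ∧
      ∀ h, ‖T (Function.update x q h) - (c₀ + h * α + conj h * β + h ^ 2 * γ + conj h ^ 2 * δ +
        ((‖h‖ ^ 2 : ℝ) : ℂ) * κ)‖ ≤ C₃ * ‖h‖ ^ 3) :
    ‖∫ x, T x ∂Measure.pi (Function.update lam q μ) -
      ∫ x, T x ∂Measure.pi (Function.update lam q ν)‖ ≤
    2 * (1 + ε₂) * ∫ x, g x ∂Measure.pi (Function.update lam q ν) +
      (2 * ε₁ * C₁ + 2 * ε₂ * C₂ + 2 * (1 + ε₂) * (C₃ * (1 + L)) + 2 * C₃ * L) := by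
  have hε₁ : 0 ≤ ε₁ := (norm_nonneg _).trans hμ.mean
  have hε₂ : 0 ≤ ε₂ := (abs_nonneg _).trans hμ.var
  have hu : ∀ x : ι → ℂ, Measurable fun h : ℂ => Function.update x q h := fun x =>
    measurable_update x
  have hgD : ∀ x, ‖g x‖ ≤ D := fun x => by rw [Real.norm_of_nonneg (hg0 x)]; exact hD x
  have intT : ∀ (ρ : Measure ℂ) [IsProbabilityMeasure ρ] (x : ι → ℂ),
      Integrable (fun h => T (Function.update x q h)) ρ := fun ρ _ x =>
    Integrable.of_bound (hT.comp (hu x)).aestronglyMeasurable CT (ae_of_all _ fun _ => hCT _)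
  have intTT : ∀ (ρ : Measure ℂ) [IsProbabilityMeasure ρ],
      Integrable (fun x => ∫ h, T (Function.update x q h) ∂ρ) (Measure.pi lam) := fun ρ _ =>
    (Integrable.of_bound (hT.comp (measurable_update_prod q)).aestronglyMeasurable CT
      (ae_of_all _ fun x => hCT _) :
      Integrable (fun x : (ι → ℂ) × ℂ => T (Function.update x.1 q x.2))
        ((Measure.pi lam).prod ρ)).integral_prod_left
  have intg : Integrable (fun x => ∫ h, g (Function.update x q h) ∂ν) (Measure.pi lam) :=
    (Integrable.of_bound (hg.comp (measurable_update_prod q)).aestronglyMeasurable D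
      (ae_of_all _ fun x => hgD _) :
      Integrable (fun x : (ι → ℂ) × ℂ => g (Function.update x.1 q x.2))
        ((Measure.pi lam).prod ν)).integral_prod_left
  rw [integral_pi_update lam μ q hT.stronglyMeasurable hCT,
    integral_pi_update lam ν q hT.stronglyMeasurable hCT,
    integral_pi_update lam ν q hg.stronglyMeasurable hgD, ← integral_sub (intTT μ) (intTT ν)]
  have pt : ∀ x : ι → ℂ, ‖∫ h, T (Function.update x q h) ∂μ - ∫ h, T (Function.update x q h) ∂ν‖ ≤
      2 * (1 + ε₂) * ∫ h, g (Function.update x q h) ∂ν +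
      (2 * ε₁ * C₁ + 2 * ε₂ * C₂ + 2 * (1 + ε₂) * (C₃ * (1 + L)) + 2 * C₃ * L) := by
    intro x
    obtain ⟨c₀, α, β, γ, δ, κ, h1, h2, h3, h4⟩ := hexp x
    have hC₃ : 0 ≤ C₃ := by simpa using (norm_nonneg _).trans (h4 1)
    have b := norm_integral_sub_le_of_expansion hμ hν (intT μ x) (intT ν x) h4
    have ig : Integrable (fun h => g (Function.update x q h)) ν :=
      Integrable.of_bound (hg.comp (hu x)).aestronglyMeasurable D (ae_of_all _ fun _ => hgD _)
    -- `γ` and `δ` do not depend on `h`, whereas `g` is evaluated with `h` in place. Averaging over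
    -- `ν` turns the pointwise bound into one by the mean of `g` under the current law, which is the
    -- quantity controlled when `q` is chosen.
    have c : ‖γ‖ + ‖δ‖ ≤ ∫ h, g (Function.update x q h) ∂ν + C₃ * (1 + L) := by
      have : ∫ _h : ℂ, (‖γ‖ + ‖δ‖) ∂ν ≤ ∫ h, (g (Function.update x q h) + C₃ * ‖h‖) ∂ν :=
        integral_mono (integrable_const _) (ig.add (hν.integrable_norm.const_mul C₃)) h3
      rw [integral_add ig (hν.integrable_norm.const_mul C₃), integral_const_mul] at this
      simp only [integral_const, probReal_univ, one_smul] at this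
      linarith [mul_le_mul_of_nonneg_left hν.integral_norm_le hC₃]
    refine b.trans ?_
    have e1 := mul_le_mul_of_nonneg_left h1 (by positivity : 0 ≤ 2 * ε₁)
    have e2 := mul_le_mul_of_nonneg_left h2 (by positivity : 0 ≤ 2 * ε₂)
    have e3 := mul_le_mul_of_nonneg_left c (by positivity : 0 ≤ 2 * (1 + ε₂))
    linarith
  refine (norm_integral_le_of_norm_le ((intg.const_mul _).add (integrable_const _))
    (ae_of_all _ pt)).trans (le_of_eq ?_)
  rw [integral_add' (intg.const_mul _) (integrable_const _), integral_const_mul]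
  simp

open scoped ComplexConjugate in
/-- Lindeberg's replacement method for functions of independent complex variables, with the
variables replaced in an order chosen so that the terms which are not matched (those in `h ^ 2`
and `conj h ^ 2`) contribute a harmonic sum. -/
theorem norm_integral_pi_sub_le {ι : Type*} [Fintype ι] [DecidableEq ι] {μ ν : ι → Measure ℂ}
    [∀ q, IsProbabilityMeasure (μ q)] [∀ q, IsProbabilityMeasure (ν q)] {ε₁ ε₂ L : ℝ}
    (hε₂ : 0 ≤ ε₂)
    (hμ : ∀ q, IsNearStandard (μ q) ε₁ ε₂ L) (hν : ∀ q, IsNearStandard (ν q) ε₁ ε₂ L)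
    {T : (ι → ℂ) → ℂ} (hT : Measurable T) {CT : ℝ} (hCT : ∀ x, ‖T x‖ ≤ CT)
    {g : ι → (ι → ℂ) → ℝ} (hg : ∀ q, Measurable (g q)) (hg0 : ∀ q x, 0 ≤ g q x) {D : ℝ}
    (hD : ∀ x, ∑ q, g q x ≤ D) {C₁ C₂ C₃ : ℝ}
    (hexp : ∀ q x, ∃ c₀ α β γ δ κ : ℂ, ‖α‖ + ‖β‖ ≤ C₁ ∧ ‖κ‖ ≤ C₂ ∧
      (∀ h, ‖γ‖ + ‖δ‖ ≤ g q (Function.update x q h) + C₃ * ‖h‖) ∧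
      ∀ h, ‖T (Function.update x q h) - (c₀ + h * α + conj h * β + h ^ 2 * γ + conj h ^ 2 * δ +
        ((‖h‖ ^ 2 : ℝ) : ℂ) * κ)‖ ≤ C₃ * ‖h‖ ^ 3) :
    ‖∫ x, T x ∂Measure.pi μ - ∫ x, T x ∂Measure.pi ν‖ ≤
      2 * (1 + ε₂) * (D * harmonic (Fintype.card ι)) + Fintype.card ι *
      (2 * ε₁ * C₁ + 2 * ε₂ * C₂ + 2 * (1 + ε₂) * (C₃ * (1 + L)) + 2 * C₃ * L) := by
  set e := 2 * ε₁ * C₁ + 2 * ε₂ * C₂ + 2 * (1 + ε₂) * (C₃ * (1 + L)) + 2 * C₃ * L with he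
  have hgD : ∀ q x, g q x ≤ D := fun q x =>
    (Finset.single_le_sum (fun i _ => hg0 i x) (Finset.mem_univ q)).trans (hD x)
  -- `R` is the set of coordinates still carrying `ν`; induction on its size leaves the replacement
  -- order free.
  have main : ∀ (k : ℕ) (R : Finset ι) (lam : ι → Measure ℂ), R.card = k →
      (∀ q, IsProbabilityMeasure (lam q)) → (∀ q ∈ R, lam q = ν q) → (∀ q ∉ R, lam q = μ q) →
      ‖∫ x, T x ∂Measure.pi μ - ∫ x, T x ∂Measure.pi lam‖ ≤
        2 * (1 + ε₂) * (D * harmonic k) + k * e := by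
    intro k
    induction k with
    | zero =>
      intro R lam hR _ _ h2
      have : lam = μ := by
        funext q
        exact h2 q (by rw [Finset.card_eq_zero.1 hR]; simp)
      simp [this]
    | succ k ih =>
      intro R lam hR inst h1 h2
      have hsum : ∑ q ∈ R, ∫ x, g q x ∂Measure.pi lam ≤ ∑ _q ∈ R, D / (k + 1 : ℝ) := by
        rw [Finset.sum_const, hR, nsmul_eq_mul]
        push_cast
        rw [mul_div_cancel₀ _ (by positivity)]
        have ig : ∀ q, Integrable (g q) (Measure.pi lam) := fun q =>
          Integrable.of_bound (hg q).aestronglyMeasurable D (ae_of_all _ fun x => by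
            rw [Real.norm_of_nonneg (hg0 q x)]; exact hgD q x)
        rw [← integral_finsetSum _ fun q _ => ig q]
        have : ∫ x, ∑ q ∈ R, g q x ∂Measure.pi lam ≤ ∫ _x, D ∂Measure.pi lam :=
          integral_mono (integrable_finsetSum _ fun q _ => ig q) (integrable_const _) fun x =>
            (Finset.sum_le_sum_of_subset_of_nonneg (Finset.subset_univ R)
              fun q _ _ => hg0 q x).trans (hD x)
        simpa using this
      -- Pigeonhole: the `k + 1` expectations sum to at most `D`, so one is at most `D / (k + 1)`.
      -- These bounds add up to `D` times the harmonic number.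
      obtain ⟨q, hq, hgq⟩ := Finset.exists_le_of_sum_le
        (Finset.card_pos.1 (by rw [hR]; exact k.succ_pos)) hsum
      have el : Function.update lam q (ν q) = lam := by
        rw [← h1 q hq]; exact Function.update_eq_self q lam
      have inst' : ∀ i, IsProbabilityMeasure (Function.update lam q (μ q) i) := by
        intro i
        by_cases hi : i = q
        · subst hi; simp; infer_instance
        · simp [hi]; exact inst i
      have hih := ih (R.erase q) (Function.update lam q (μ q))
        (by rw [Finset.card_erase_of_mem hq, hR]; rfl) inst'
        (fun i hi => by
          rw [Function.update_of_ne (Finset.ne_of_mem_erase hi)]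
          exact h1 i (Finset.mem_of_mem_erase hi))
        (fun i hi => by
          by_cases hiq : i = q
          · subst hiq; simp
          · rw [Function.update_of_ne hiq]
            exact h2 i fun h => hi (Finset.mem_erase.2 ⟨hiq, h⟩))
      have hstep := norm_integral_pi_update_sub_le (lam := lam) (hμ q) (hν q) hT hCT q (hg q)
        (hg0 q) (hgD q) (hexp q)
      rw [el, ← he] at hstep
      refine (norm_sub_le_norm_sub_add_norm_sub _
        (∫ x, T x ∂Measure.pi (Function.update lam q (μ q))) _).trans
        ((add_le_add hih hstep).trans ?_)
      rw [harmonic_succ]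
      push_cast
      have := mul_le_mul_of_nonneg_left hgq (by positivity : 0 ≤ 2 * (1 + ε₂))
      rw [div_eq_mul_inv] at this
      linarith
  have := main (Fintype.card ι) Finset.univ ν (by simp) inferInstance (fun _ _ => rfl)
    (fun q hq => absurd (Finset.mem_univ q) hq)
  exact this

/-! ### Resolvents and trace norms -/

section Resolvent

open scoped Matrix.Norms.L2Operator ComplexConjugate Matrix

variable {m : Type*} [Fintype m] [DecidableEq m]

/-- The resolvent `(H - w)⁻¹` of a matrix. -/
noncomputable def resolvMatrix (H : Matrix m m ℂ) (w : ℂ) : Matrix m m ℂ :=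
  (H - w • (1 : Matrix m m ℂ))⁻¹

theorem resolvMatrix_spec {H : Matrix m m ℂ} (hH : H.IsHermitian) {w : ℂ}
    (hw : 0 < w.im) :
    (H - w • (1 : Matrix m m ℂ)) * resolvMatrix H w = 1 ∧ ‖resolvMatrix H w‖ ≤ w.im⁻¹ := by
  have hne : ∀ i, ((hH.eigenvalues i : ℂ) - w) ≠ 0 := by
    intro i h
    have := congrArg Complex.im h
    simp at this
    exact hw.ne' this
  set U := hH.eigenvectorUnitary with hU
  set φ := Unitary.conjStarAlgAut ℂ (Matrix m m ℂ) U with hφ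
  have h1 : H - w • (1 : Matrix m m ℂ) =
      φ (Matrix.diagonal fun i => (hH.eigenvalues i : ℂ) - w) := by
    have e : (Matrix.diagonal fun i => (hH.eigenvalues i : ℂ) - w) =
        Matrix.diagonal (RCLike.ofReal ∘ hH.eigenvalues) - w • (1 : Matrix m m ℂ) := by
      rw [← Matrix.diagonal_one, ← Matrix.diagonal_smul, Matrix.diagonal_sub]
      congr 1
      funext i
      simp
    rw [e, map_sub, map_smul, map_one, hφ, ← hH.spectral_theorem]
  have h0 : (H - w • (1 : Matrix m m ℂ)) *
      φ (Matrix.diagonal fun i => 1 / ((hH.eigenvalues i : ℂ) - w)) = 1 := by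
    rw [h1, ← map_mul, Matrix.diagonal_mul_diagonal]
    simp [hne]
  have h2 : resolvMatrix H w =
      φ (Matrix.diagonal fun i => 1 / ((hH.eigenvalues i : ℂ) - w)) :=
    Matrix.inv_eq_right_inv h0
  refine ⟨by rw [h2, h0], ?_⟩
  rw [h2, hφ, Unitary.conjStarAlgAut_apply]
  rw [CStarRing.norm_mul_mem_unitary _ (Unitary.star_mem U.2), CStarRing.norm_mem_unitary_mul _ U.2,
    Matrix.l2_opNorm_diagonal, pi_norm_le_iff_of_nonneg (by positivity)]
  intro i
  rw [norm_div, norm_one, one_div]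
  refine inv_anti₀ hw ?_
  have := Complex.abs_im_le_norm ((hH.eigenvalues i : ℂ) - w)
  simp at this
  exact (le_abs_self _).trans this

theorem sub_smul_mul_resolvMatrix {H : Matrix m m ℂ} (hH : H.IsHermitian) {w : ℂ}
    (hw : 0 < w.im) : (H - w • (1 : Matrix m m ℂ)) * resolvMatrix H w = 1 :=
  (resolvMatrix_spec hH hw).1

theorem resolvMatrix_mul_sub_smul {H : Matrix m m ℂ} (hH : H.IsHermitian) {w : ℂ}
    (hw : 0 < w.im) : resolvMatrix H w * (H - w • (1 : Matrix m m ℂ)) = 1 :=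
  mul_eq_one_comm.1 (sub_smul_mul_resolvMatrix hH hw)

theorem norm_resolvMatrix_le {H : Matrix m m ℂ} (hH : H.IsHermitian) {w : ℂ}
    (hw : 0 < w.im) : ‖resolvMatrix H w‖ ≤ w.im⁻¹ :=
  (resolvMatrix_spec hH hw).2

theorem resolvMatrix_add {H Δ : Matrix m m ℂ} (hH : H.IsHermitian) (hΔ : (H + Δ).IsHermitian)
    {w : ℂ} (hw : 0 < w.im) :
    resolvMatrix (H + Δ) w =
      resolvMatrix H w - resolvMatrix (H + Δ) w * Δ * resolvMatrix H w := by
  have h1 := sub_smul_mul_resolvMatrix hH hw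
  have h2 := resolvMatrix_mul_sub_smul hΔ hw
  set G := resolvMatrix H w
  set G' := resolvMatrix (H + Δ) w
  have : G' * ((H + Δ - w • 1) - (H - w • 1)) * G = G - G' := by
    rw [mul_sub, h2, sub_mul, one_mul, mul_assoc, h1, mul_one]
  rw [add_sub_right_comm, add_sub_cancel_left] at this
  rw [this, sub_sub_cancel]

/-- The resolvent identity is substituted into itself twice, so that the perturbed resolvent
survives only in the cubic remainder, where its norm bound is enough. -/
theorem resolvMatrix_add_expand {H Δ : Matrix m m ℂ} (hH : H.IsHermitian)
    (hΔ : (H + Δ).IsHermitian) {w : ℂ} (hw : 0 < w.im) {G G' : Matrix m m ℂ}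
    (hG : G = resolvMatrix H w) (hG' : G' = resolvMatrix (H + Δ) w) :
    G' = G - G * Δ * G + G * Δ * G * Δ * G - G' * Δ * G * Δ * G * Δ * G := by
  have h : G' = G - G' * Δ * G := by rw [hG, hG']; exact resolvMatrix_add hH hΔ hw
  have h2 : G' * Δ * G = G * Δ * G - G' * Δ * G * Δ * G := by
    conv_lhs => rw [h]
    noncomm_ring
  have h3 : G' * Δ * G * Δ * G = G * Δ * G * Δ * G - G' * Δ * G * Δ * G * Δ * G := by
    conv_lhs => rw [h2]
    noncomm_ring
  rw [h2, h3] at h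
  rw [sub_sub_eq_add_sub] at h
  conv_lhs => rw [h]
  noncomm_ring

theorem norm_entry_le_l2_opNorm (M : Matrix m m ℂ) (i j : m) : ‖M i j‖ ≤ ‖M‖ := by
  have h := Matrix.l2_opNorm_mulVec M (EuclideanSpace.single j 1)
  rw [PiLp.norm_single, norm_one, mul_one] at h
  refine le_trans ?_ h
  refine le_trans (le_of_eq ?_) (PiLp.norm_apply_le _ i)
  simp

theorem sum_sq_norm_col_le (M : Matrix m m ℂ) (j : m) : ∑ i, ‖M i j‖ ^ 2 ≤ ‖M‖ ^ 2 := by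
  have h := Matrix.l2_opNorm_mulVec M (EuclideanSpace.single j 1)
  rw [PiLp.norm_single, norm_one, mul_one] at h
  have h2 := pow_le_pow_left₀ (norm_nonneg _) h 2
  rw [EuclideanSpace.norm_sq_eq] at h2
  simpa using h2

theorem norm_single_one_le (i j : m) : ‖(Matrix.single i j 1 : Matrix m m ℂ)‖ ≤ 1 := by
  have h := Matrix.l2_opNorm_conjTranspose_mul_self (Matrix.single i j 1 : Matrix m m ℂ)
  rw [Matrix.conjTranspose_single, Matrix.single_mul_single_same, star_one, one_mul,
    ← Matrix.diagonal_single, Matrix.l2_opNorm_diagonal] at h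
  have : ‖(Pi.single j 1 : m → ℂ)‖ ≤ 1 := by
    rw [pi_norm_le_iff_of_nonneg zero_le_one]
    intro k
    by_cases hk : k = j
    · subst hk; simp
    · simp [hk]
  rw [h] at this
  nlinarith [norm_nonneg (Matrix.single i j 1 : Matrix m m ℂ)]

/-- A matrix whose trace norm is at most `κ`, in the dual formulation. -/
structure TraceNormLE (E : Matrix m m ℂ) (κ : ℝ) : Prop where
  norm_le : ‖E‖ ≤ κ
  trace_le : ∀ M : Matrix m m ℂ, ‖(M * E).trace‖ ≤ κ * ‖M‖

namespace TraceNormLE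

variable {E : Matrix m m ℂ} {κ : ℝ}

theorem nonneg (h : TraceNormLE E κ) : 0 ≤ κ := (norm_nonneg _).trans h.norm_le

theorem conjTranspose (h : TraceNormLE E κ) : TraceNormLE Eᴴ κ := by
  refine ⟨by rw [Matrix.l2_opNorm_conjTranspose]; exact h.norm_le, fun M => ?_⟩
  have h1 := h.trace_le Mᴴ
  have h2 : (M * Eᴴ).trace = star (Mᴴ * E).trace := by
    rw [← Matrix.trace_conjTranspose, Matrix.conjTranspose_mul, Matrix.conjTranspose_conjTranspose,
      Matrix.trace_mul_comm]
  rw [h2, norm_star]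
  rwa [Matrix.l2_opNorm_conjTranspose] at h1

/-- The matrix has rank at most one, so its trace against `M` is the single entry `(B * M * A) j i`.
This keeps the dimension out of the trace bounds. -/
theorem mul_single_mul (A B : Matrix m m ℂ) (i j : m) (hAB : ‖A‖ * ‖B‖ ≤ κ) :
    TraceNormLE (A * Matrix.single i j 1 * B) κ := by
  refine ⟨?_, fun M => ?_⟩
  · refine (norm_mul_le _ _).trans (le_trans ?_ hAB)
    refine mul_le_mul_of_nonneg_right ?_ (norm_nonneg _)
    exact (norm_mul_le _ _).trans (mul_le_of_le_one_right (norm_nonneg _) (norm_single_one_le i j))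
  · have e : (M * (A * Matrix.single i j 1 * B)).trace = (B * M * A) j i := by
      rw [show M * (A * Matrix.single i j 1 * B) = M * A * Matrix.single i j 1 * B by noncomm_ring,
        Matrix.trace_mul_comm, ← mul_assoc, ← mul_assoc, Matrix.trace_mul_single]
      simp
    rw [e]
    refine (norm_entry_le_l2_opNorm _ _ _).trans ((norm_mul_le _ _).trans ?_)
    calc ‖B * M‖ * ‖A‖ ≤ ‖B‖ * ‖M‖ * ‖A‖ :=
          mul_le_mul_of_nonneg_right (norm_mul_le _ _) (norm_nonneg _)
      _ = ‖A‖ * ‖B‖ * ‖M‖ := by ring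
      _ ≤ κ * ‖M‖ := mul_le_mul_of_nonneg_right hAB (norm_nonneg _)

end TraceNormLE

end Resolvent

/-! ### Expansion of the resolvent trace in one entry -/

section Expansion

open scoped Matrix.Norms.L2Operator ComplexConjugate Matrix

variable {m : Type*} [Fintype m] [DecidableEq m]

namespace TraceNormLE

theorem add {E F : Matrix m m ℂ} {κ κ' : ℝ} (hE : TraceNormLE E κ) (hF : TraceNormLE F κ') :
    TraceNormLE (E + F) (κ + κ') := by
  refine ⟨(norm_add_le _ _).trans (add_le_add hE.norm_le hF.norm_le), fun M => ?_⟩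
  rw [mul_add, Matrix.trace_add, add_mul]
  exact (norm_add_le _ _).trans (add_le_add (hE.trace_le M) (hF.trace_le M))

theorem smul {E : Matrix m m ℂ} {κ : ℝ} (hE : TraceNormLE E κ) (c : ℂ) :
    TraceNormLE (c • E) (‖c‖ * κ) := by
  refine ⟨(norm_smul_le _ _).trans (mul_le_mul_of_nonneg_left hE.norm_le (norm_nonneg _)),
    fun M => ?_⟩
  rw [Matrix.mul_smul, Matrix.trace_smul, smul_eq_mul, norm_mul, mul_assoc]
  exact mul_le_mul_of_nonneg_left (hE.trace_le M) (norm_nonneg _)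

theorem norm_trace_mul_mul_le {E : Matrix m m ℂ} {κ : ℝ} (hE : TraceNormLE E κ)
    {P Q : Matrix m m ℂ} {a b : ℝ} (hP : ‖P‖ ≤ a) (hQ : ‖Q‖ ≤ b) :
    ‖(P * E * Q).trace‖ ≤ κ * (a * b) := by
  rw [Matrix.trace_mul_comm, ← mul_assoc]
  refine (hE.trace_le _).trans (mul_le_mul_of_nonneg_left ?_ hE.nonneg)
  rw [mul_comm a b]
  exact (norm_mul_le _ _).trans (mul_le_mul hQ hP (norm_nonneg _) ((norm_nonneg _).trans hQ))

/-- One trace-norm factor controls the trace; the other is absorbed through its operator norm. -/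
theorem norm_trace_mul_mul_mul_mul_le {E F : Matrix m m ℂ} {κ κ' : ℝ} (hE : TraceNormLE E κ)
    (hF : TraceNormLE F κ') {P Q R : Matrix m m ℂ} {a b c : ℝ} (hP : ‖P‖ ≤ a) (hQ : ‖Q‖ ≤ b)
    (hR : ‖R‖ ≤ c) : ‖(P * E * Q * F * R).trace‖ ≤ κ * κ' * (a * b * c) := by
  have ha := (norm_nonneg _).trans hP
  have hPEQ : ‖P * E * Q‖ ≤ a * κ * b :=
    (norm_mul_le _ _).trans (mul_le_mul ((norm_mul_le _ _).trans
      (mul_le_mul hP hE.norm_le (norm_nonneg _) ha)) hQ (norm_nonneg _)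
      (mul_nonneg ha hE.nonneg))
  refine (hF.norm_trace_mul_mul_le hPEQ hR).trans (le_of_eq (by ring))

end TraceNormLE

/-- The Hermitian perturbation `s (h E + conj h E*)`. -/
noncomputable def hermPerturb (E : Matrix m m ℂ) (s : ℝ) (h : ℂ) : Matrix m m ℂ :=
  ((s : ℂ) * h) • E + ((s : ℂ) * conj h) • Eᴴ

omit [Fintype m] [DecidableEq m] in
theorem isHermitian_hermPerturb (E : Matrix m m ℂ) (s : ℝ) (h : ℂ) :
    (hermPerturb E s h).IsHermitian := by
  unfold hermPerturb Matrix.IsHermitian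
  rw [Matrix.conjTranspose_add, Matrix.conjTranspose_smul, Matrix.conjTranspose_smul,
    Matrix.conjTranspose_conjTranspose, add_comm]
  simp

theorem traceNormLE_hermPerturb {E : Matrix m m ℂ} {κ : ℝ} (hE : TraceNormLE E κ) {s : ℝ}
    (hs : 0 ≤ s) (h : ℂ) : TraceNormLE (hermPerturb E s h) (2 * s * κ * ‖h‖) := by
  have := (hE.smul ((s : ℂ) * h)).add (hE.conjTranspose.smul ((s : ℂ) * conj h))
  have e : ‖(s : ℂ) * h‖ * κ + ‖(s : ℂ) * conj h‖ * κ = 2 * s * κ * ‖h‖ := by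
    simp [abs_of_nonneg hs]
    ring
  rwa [e] at this

theorem norm_resolvMatrix_add_sub_le {H E : Matrix m m ℂ} (hH : H.IsHermitian) {κ : ℝ}
    (hE : TraceNormLE E κ) {s : ℝ} (hs : 0 ≤ s) {w : ℂ} (hw : 0 < w.im) (h : ℂ) :
    ‖resolvMatrix H w - resolvMatrix (H + hermPerturb E s h) w‖ ≤
      2 * s * κ * ‖h‖ * w.im⁻¹ ^ 2 := by
  have hH' := hH.add (isHermitian_hermPerturb E s h)
  rw [resolvMatrix_add hH hH' hw, sub_sub_cancel]
  have hΔ := traceNormLE_hermPerturb hE hs h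
  have hg : 0 ≤ w.im⁻¹ := by positivity
  refine (norm_mul_le _ _).trans ((mul_le_mul ((norm_mul_le _ _).trans (mul_le_mul
    (norm_resolvMatrix_le hH' hw) hΔ.norm_le (norm_nonneg _) hg)) (norm_resolvMatrix_le hH hw)
    (norm_nonneg _) (mul_nonneg hg hΔ.nonneg)).trans (le_of_eq (by ring)))

/-- Second order expansion of the trace of the resolvent under `hermPerturb`. -/
theorem norm_trace_resolvMatrix_sub_expansion_le {H E : Matrix m m ℂ} (hH : H.IsHermitian)
    {κ : ℝ} (hE : TraceNormLE E κ) {s : ℝ} (hs : 0 ≤ s) {w : ℂ} (hw : 0 < w.im)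
    {G : Matrix m m ℂ} (hG : G = resolvMatrix H w) (h : ℂ) :
    ‖(resolvMatrix (H + hermPerturb E s h) w).trace - (G.trace + h * (-s * (G * E * G).trace) +
      conj h * (-s * (G * Eᴴ * G).trace) + h ^ 2 * (s ^ 2 * (G * E * G * E * G).trace) +
      conj h ^ 2 * (s ^ 2 * (G * Eᴴ * G * Eᴴ * G).trace) + ((‖h‖ ^ 2 : ℝ) : ℂ) *
      (s ^ 2 * ((G * E * G * Eᴴ * G).trace + (G * Eᴴ * G * E * G).trace)))‖ ≤
      8 * s ^ 3 * κ ^ 3 * w.im⁻¹ ^ 4 * ‖h‖ ^ 3 := by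
  have hH' := hH.add (isHermitian_hermPerturb E s h)
  have hΔ := traceNormLE_hermPerturb hE hs h
  have hex := resolvMatrix_add_expand hH hH' hw hG rfl
  have hGn : ‖G‖ ≤ w.im⁻¹ := hG ▸ norm_resolvMatrix_le hH hw
  have hG'n := norm_resolvMatrix_le hH' hw
  set G' := resolvMatrix (H + hermPerturb E s h) w
  set Δ := hermPerturb E s h with hΔdef
  have hg : 0 ≤ w.im⁻¹ := by positivity
  -- The remainder is read as `(G' * Δ * G) * Δ * G * Δ * G`, so the bound for two trace-norm
  -- factors applies.
  have hP : ‖G' * Δ * G‖ ≤ w.im⁻¹ * (2 * s * κ * ‖h‖) * w.im⁻¹ :=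
    (norm_mul_le _ _).trans (mul_le_mul ((norm_mul_le _ _).trans (mul_le_mul
      hG'n hΔ.norm_le (norm_nonneg _) hg)) hGn (norm_nonneg _) (mul_nonneg hg hΔ.nonneg))
  have hR := hΔ.norm_trace_mul_mul_mul_mul_le hΔ hP hGn hGn
  have e1 : (G * Δ * G).trace = s * h * (G * E * G).trace + s * conj h * (G * Eᴴ * G).trace := by
    simp only [hΔdef, hermPerturb, mul_add, add_mul, Matrix.mul_smul, Matrix.smul_mul,
      Matrix.trace_add, Matrix.trace_smul, smul_eq_mul]
  have hh : ((‖h‖ ^ 2 : ℝ) : ℂ) = h * conj h := by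
    rw [Complex.mul_conj, Complex.normSq_eq_norm_sq]
  have e2 : (G * Δ * G * Δ * G).trace = s ^ 2 * (h ^ 2 * (G * E * G * E * G).trace +
      h * conj h * ((G * E * G * Eᴴ * G).trace + (G * Eᴴ * G * E * G).trace) +
      conj h ^ 2 * (G * Eᴴ * G * Eᴴ * G).trace) := by
    simp only [hΔdef, hermPerturb, mul_add, add_mul, Matrix.mul_smul, Matrix.smul_mul,
      Matrix.trace_add, Matrix.trace_smul, smul_eq_mul]
    ring
  have e3 : G'.trace = G.trace - (G * Δ * G).trace + (G * Δ * G * Δ * G).trace -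
      (G' * Δ * G * Δ * G * Δ * G).trace := by
    rw [← Matrix.trace_sub, ← Matrix.trace_add, ← Matrix.trace_sub, ← hex]
  rw [e3, e1, e2, hh]
  refine (le_of_eq ?_).trans (hR.trans (le_of_eq (by ring)))
  rw [← norm_neg]
  congr 1
  ring

/-- Lets the second order coefficient at the centre of the expansion be bounded by the one at the
actual configuration. The three resolvents are exchanged one at a time, each costing `2 * s * κ ^ 3
* w.im⁻¹ ^ 4 * ‖h‖`. -/
theorem norm_trace_quartic_sub_le {H E F : Matrix m m ℂ} (hH : H.IsHermitian)
    {κ : ℝ} (hE : TraceNormLE E κ) (hF : TraceNormLE F κ) {s : ℝ} (hs : 0 ≤ s) {w : ℂ}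
    (hw : 0 < w.im) {G G' : Matrix m m ℂ} (hG : G = resolvMatrix H w) (h : ℂ)
    (hG' : G' = resolvMatrix (H + hermPerturb E s h) w) :
    ‖(G * F * G * F * G).trace‖ ≤ ‖(G' * F * G' * F * G').trace‖ +
      6 * s * κ ^ 3 * w.im⁻¹ ^ 4 * ‖h‖ := by
  have hH' := hH.add (isHermitian_hermPerturb E s h)
  have hd : ‖G - G'‖ ≤ 2 * s * κ * ‖h‖ * w.im⁻¹ ^ 2 := by
    rw [hG, hG']; exact norm_resolvMatrix_add_sub_le hH hE hs hw h
  have hGn : ‖G‖ ≤ w.im⁻¹ := hG ▸ norm_resolvMatrix_le hH hw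
  have hG'n : ‖G'‖ ≤ w.im⁻¹ := hG' ▸ norm_resolvMatrix_le hH' hw
  have e : G * F * G * F * G = G' * F * G' * F * G' + (G - G') * F * G * F * G +
      G' * F * (G - G') * F * G + G' * F * G' * F * (G - G') := by noncomm_ring
  rw [e, Matrix.trace_add, Matrix.trace_add, Matrix.trace_add]
  have b1 := hF.norm_trace_mul_mul_mul_mul_le hF hd hGn hGn
  have b2 := hF.norm_trace_mul_mul_mul_mul_le hF hG'n hd hGn
  have b3 := hF.norm_trace_mul_mul_mul_mul_le hF hG'n hG'n hd
  refine (norm_add_le _ _).trans ((add_le_add ((norm_add_le _ _).trans (add_le_add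
    (norm_add_le _ _) le_rfl)) le_rfl).trans ?_)
  have r : κ * κ * (2 * s * κ * ‖h‖ * w.im⁻¹ ^ 2 * w.im⁻¹ * w.im⁻¹) +
    κ * κ * (w.im⁻¹ * (2 * s * κ * ‖h‖ * w.im⁻¹ ^ 2) * w.im⁻¹) +
    κ * κ * (w.im⁻¹ * w.im⁻¹ * (2 * s * κ * ‖h‖ * w.im⁻¹ ^ 2)) =
      6 * s * κ ^ 3 * w.im⁻¹ ^ 4 * ‖h‖ := by ring
  linarith

/-- Between two copies of the matrix unit only one scalar entry survives. The trace thus splits into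
a product of two entries at the same position, which is square-summable over positions. -/
theorem trace_mul_single_sq (A B G : Matrix m m ℂ) (i j : m) :
    (G * (A * Matrix.single i j 1 * B) * G * (A * Matrix.single i j 1 * B) * G).trace =
      (B * G * A) j i * (B * (G * G) * A) j i := by
  have e : G * (A * Matrix.single i j 1 * B) * G * (A * Matrix.single i j 1 * B) * G =
      G * A * (Matrix.single i j 1 * (B * G * A) * Matrix.single i j 1) * (B * G) := by
    noncomm_ring
  rw [e, Matrix.single_mul_mul_single, Matrix.trace_mul_comm, ← mul_assoc,
    Matrix.trace_mul_single]
  simp [mul_assoc, mul_comm]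

theorem norm_trace_mul_single_sq_le (A B G : Matrix m m ℂ) (i j : m) :
    ‖(G * (A * Matrix.single i j 1 * B) * G * (A * Matrix.single i j 1 * B) * G).trace‖ ≤
      (‖(B * G * A) j i‖ ^ 2 + ‖(B * (G * G) * A) j i‖ ^ 2) / 2 := by
  rw [trace_mul_single_sq, norm_mul]
  linarith [two_mul_le_add_sq ‖(B * G * A) j i‖ ‖(B * (G * G) * A) j i‖]

/-- The Hermitian matrix `s ∑ q, (x q E q + conj (x q) (E q)*)`. -/
noncomputable def hermSum {ι : Type*} [Fintype ι] (E : ι → Matrix m m ℂ) (s : ℝ) (x : ι → ℂ) :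
    Matrix m m ℂ := ∑ q, hermPerturb (E q) s (x q)

section hermSum

variable {ι : Type*} [Fintype ι] (E : ι → Matrix m m ℂ) (s : ℝ)

omit [Fintype m] [DecidableEq m] in
theorem isHermitian_hermSum (x : ι → ℂ) : (hermSum E s x).IsHermitian := by
  unfold hermSum Matrix.IsHermitian
  rw [Matrix.conjTranspose_sum]
  exact Finset.sum_congr rfl fun q _ => isHermitian_hermPerturb (E q) s (x q)

-- Each expansion is centred at the configuration whose `q`-th entry is `0`.
omit [Fintype m] [DecidableEq m] in
theorem hermSum_update [DecidableEq ι] (x : ι → ℂ) (q : ι) (h : ℂ) :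
    hermSum E s (Function.update x q h) =
      hermSum E s (Function.update x q 0) + hermPerturb (E q) s h := by
  unfold hermSum
  rw [← Finset.add_sum_erase _ _ (Finset.mem_univ q),
    ← Finset.add_sum_erase (f := fun i => hermPerturb (E i) s (Function.update x q 0 i)) _
      (Finset.mem_univ q)]
  have : ∑ i ∈ Finset.univ.erase q, hermPerturb (E i) s (Function.update x q h i) =
      ∑ i ∈ Finset.univ.erase q, hermPerturb (E i) s (Function.update x q 0 i) :=
    Finset.sum_congr rfl fun i hi => by
      rw [Function.update_of_ne (Finset.ne_of_mem_erase hi),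
        Function.update_of_ne (Finset.ne_of_mem_erase hi)]
  rw [this]
  simp [hermPerturb, add_comm]

/-- Cramer's rule with a nonvanishing determinant; it supplies the measurability that the
replacement argument needs. -/
theorem continuous_resolvMatrix_hermSum {w : ℂ} (hw : 0 < w.im) :
    Continuous fun x => resolvMatrix (hermSum E s x) w := by
  have hc : Continuous fun x => hermSum E s x - w • (1 : Matrix m m ℂ) := by
    unfold hermSum hermPerturb
    fun_prop
  unfold resolvMatrix
  simp only [Matrix.inv_def, Ring.inverse_eq_inv']
  refine Continuous.smul (hc.matrix_det.inv₀ fun x => ?_) hc.matrix_adjugate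
  have h := sub_smul_mul_resolvMatrix (isHermitian_hermSum E s x) hw
  have h2 := congrArg Matrix.det h
  rw [Matrix.det_mul, Matrix.det_one] at h2
  exact left_ne_zero_of_mul_eq_one h2

end hermSum

theorem norm_trace_le (M : Matrix m m ℂ) : ‖M.trace‖ ≤ Fintype.card m * ‖M‖ := by
  unfold Matrix.trace
  refine (norm_sum_le _ _).trans ?_
  refine (Finset.sum_le_sum fun i _ => norm_entry_le_l2_opNorm M i i).trans (le_of_eq ?_)
  simp

/-- Comparison of the expected traces of the resolvent of `hermSum E s x` under two product
measures. -/
theorem norm_integral_trace_resolvMatrix_sub_le {ι : Type*} [Fintype ι] [DecidableEq ι]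
    {μ ν : ι → Measure ℂ} [∀ q, IsProbabilityMeasure (μ q)] [∀ q, IsProbabilityMeasure (ν q)]
    {ε₁ ε₂ L : ℝ} (hε₂ : 0 ≤ ε₂)
    (hμ : ∀ q, IsNearStandard (μ q) ε₁ ε₂ L) (hν : ∀ q, IsNearStandard (ν q) ε₁ ε₂ L)
    {E : ι → Matrix m m ℂ} {κ : ℝ} (hE : ∀ q, TraceNormLE (E q) κ) {s : ℝ} (hs : 0 ≤ s)
    {w : ℂ} (hw : 0 < w.im) {D : ℝ}
    (hD : ∀ G : Matrix m m ℂ, ‖G‖ ≤ w.im⁻¹ → ∑ q, (‖(G * E q * G * E q * G).trace‖ +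
      ‖(G * (E q)ᴴ * G * (E q)ᴴ * G).trace‖) ≤ D) :
    ‖∫ x, (resolvMatrix (hermSum E s x) w).trace ∂Measure.pi μ -
      ∫ x, (resolvMatrix (hermSum E s x) w).trace ∂Measure.pi ν‖ ≤
      2 * (1 + ε₂) * (s ^ 2 * D * harmonic (Fintype.card ι)) + Fintype.card ι *
      (2 * ε₁ * (2 * s * κ * w.im⁻¹ ^ 2) + 2 * ε₂ * (2 * s ^ 2 * κ ^ 2 * w.im⁻¹ ^ 3) +
        2 * (1 + ε₂) * ((12 * s ^ 3 * κ ^ 3 * w.im⁻¹ ^ 4) * (1 + L)) +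
        2 * (12 * s ^ 3 * κ ^ 3 * w.im⁻¹ ^ 4) * L) := by
  have hc := continuous_resolvMatrix_hermSum E s hw
  have hGn : ∀ x, ‖resolvMatrix (hermSum E s x) w‖ ≤ w.im⁻¹ := fun x =>
    norm_resolvMatrix_le (isHermitian_hermSum E s x) hw
  have hg : 0 ≤ w.im⁻¹ := by positivity
  refine norm_integral_pi_sub_le hε₂ hμ hν (T := fun x => (resolvMatrix (hermSum E s x) w).trace)
    hc.matrix_trace.measurable (CT := Fintype.card m * w.im⁻¹)
    (fun x => (norm_trace_le _).trans (mul_le_mul_of_nonneg_left (hGn x) (Nat.cast_nonneg _)))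
    (g := fun q x => s ^ 2 * (‖(resolvMatrix (hermSum E s x) w * E q *
      resolvMatrix (hermSum E s x) w * E q * resolvMatrix (hermSum E s x) w).trace‖ +
      ‖(resolvMatrix (hermSum E s x) w * (E q)ᴴ * resolvMatrix (hermSum E s x) w * (E q)ᴴ *
        resolvMatrix (hermSum E s x) w).trace‖)) (fun q => ?_) (fun q x => by positivity)
    (fun x => ?_) (fun q x => ?_)
  · refine Continuous.measurable ?_
    have h1 : ∀ F : Matrix m m ℂ, Continuous fun x => ‖(resolvMatrix (hermSum E s x) w * F *
        resolvMatrix (hermSum E s x) w * F * resolvMatrix (hermSum E s x) w).trace‖ := fun F =>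
      ((((hc.mul continuous_const).mul hc).mul continuous_const).mul hc).matrix_trace.norm
    exact ((h1 _).add (h1 _)).const_mul _
  · rw [← Finset.mul_sum]
    exact mul_le_mul_of_nonneg_left (hD _ (hGn x)) (sq_nonneg s)
  · have hH := isHermitian_hermSum E s (Function.update x q 0)
    have hκ := (hE q).nonneg
    have hGn0 := hGn (Function.update x q 0)
    have b1 := (hE q).norm_trace_mul_mul_le hGn0 hGn0
    have b1' := (hE q).conjTranspose.norm_trace_mul_mul_le hGn0 hGn0
    have b2 := (hE q).norm_trace_mul_mul_mul_mul_le (hE q).conjTranspose hGn0 hGn0 hGn0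
    have b2' := (hE q).conjTranspose.norm_trace_mul_mul_mul_mul_le (hE q) hGn0 hGn0 hGn0
    have b3 := fun h => norm_trace_quartic_sub_le hH (hE q) (hE q) hs hw rfl h rfl
    have b3' := fun h =>
      norm_trace_quartic_sub_le hH (hE q) (hE q).conjTranspose hs hw rfl h rfl
    have b4 := norm_trace_resolvMatrix_sub_expansion_le hH (hE q) hs hw rfl
    set G := resolvMatrix (hermSum E s (Function.update x q 0)) w
    refine ⟨G.trace, -s * (G * E q * G).trace, -s * (G * (E q)ᴴ * G).trace,
      s ^ 2 * (G * E q * G * E q * G).trace, s ^ 2 * (G * (E q)ᴴ * G * (E q)ᴴ * G).trace,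
      s ^ 2 * ((G * E q * G * (E q)ᴴ * G).trace + (G * (E q)ᴴ * G * E q * G).trace),
      ?_, ?_, fun h => ?_, fun h => ?_⟩
    · rw [norm_mul, norm_mul]
      simp only [norm_neg, Complex.norm_real, Real.norm_eq_abs, abs_of_nonneg hs]
      have := mul_le_mul_of_nonneg_left (add_le_add b1 b1') hs
      linarith
    · rw [norm_mul]
      simp only [norm_pow, Complex.norm_real, Real.norm_eq_abs, abs_of_nonneg hs]
      have := mul_le_mul_of_nonneg_left ((norm_add_le _ _).trans (add_le_add b2 b2')) (sq_nonneg s)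
      linarith
    · rw [norm_mul, norm_mul]
      simp only [norm_pow, Complex.norm_real, Real.norm_eq_abs, abs_of_nonneg hs]
      rw [hermSum_update]
      have := mul_le_mul_of_nonneg_left (add_le_add (b3 h) (b3' h)) (sq_nonneg s)
      linarith
    · rw [hermSum_update]
      refine (b4 h).trans ?_
      -- The constant `12` serves twice: it dominates the `8` of the Taylor remainder and equals the
      -- `6 + 6` from moving `γ` and `δ` to the actual configuration.
      gcongr
      norm_num

end Expansion

/-! ### Hermitization of the sample covariance matrix -/

section Linearization

open scoped Matrix.Norms.L2Operator ComplexConjugate Matrix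

variable {k l : Type*} [Fintype k] [DecidableEq k] [Fintype l] [DecidableEq l]

/-- The trace of the resolvent of the Hermitization of `Y` in terms of that of `Y Y*`. -/
theorem trace_resolvMatrix_fromBlocks (Y : Matrix k l ℂ) {z w : ℂ} (hz : 0 < z.im)
    (hwz : w * w = z) :
    (resolvMatrix (Matrix.fromBlocks 0 Y Yᴴ 0) w).trace =
      2 * w * (resolvMatrix (Y * Yᴴ) z).trace +
        ((Fintype.card k : ℂ) - Fintype.card l) / w := by
  have hw0 : w ≠ 0 := by
    rintro rfl
    simp [← hwz] at hz
  have hR := sub_smul_mul_resolvMatrix (Matrix.isHermitian_mul_conjTranspose_self Y) hz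
  set R := resolvMatrix (Y * Yᴴ) z with hRdef
  have hYR : Y * Yᴴ * R = 1 + z • R := by
    rw [sub_mul, Matrix.smul_mul, one_mul] at hR
    rw [← hR]; abel
  -- Block inversion by Schur complement. The lower right block is rewritten through `R`, and `Y *
  -- Yᴴ * R = 1 + z • R` then evaluates its trace.
  have hinv : resolvMatrix (Matrix.fromBlocks 0 Y Yᴴ 0) w =
      Matrix.fromBlocks (w • R) (R * Y) (Yᴴ * R) (w⁻¹ • (Yᴴ * R * Y) - w⁻¹ • 1) := by
    unfold resolvMatrix
    apply Matrix.inv_eq_right_inv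
    have e1 : (Matrix.fromBlocks 0 Y Yᴴ 0 - w • (1 : Matrix (k ⊕ l) (k ⊕ l) ℂ)) =
        Matrix.fromBlocks (-(w • 1)) Y Yᴴ (-(w • 1)) := by
      rw [← Matrix.fromBlocks_one, Matrix.fromBlocks_smul, sub_eq_add_neg, Matrix.fromBlocks_neg,
        Matrix.fromBlocks_add]
      simp
    rw [e1, Matrix.fromBlocks_multiply, ← Matrix.fromBlocks_one]
    congr 1
    · rw [← Matrix.mul_assoc, hYR]
      simp only [neg_mul, Matrix.smul_mul, one_mul, smul_smul, hwz]
      abel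
    · have : Y * (Yᴴ * R * Y) = Y + z • (R * Y) := by
        rw [← Matrix.mul_assoc, ← Matrix.mul_assoc, hYR, Matrix.add_mul, Matrix.one_mul,
          Matrix.smul_mul]
      rw [Matrix.mul_sub, Matrix.mul_smul, this, Matrix.mul_smul, Matrix.mul_one, smul_add, smul_smul, ← hwz,
        ← mul_assoc, inv_mul_cancel₀ hw0, one_mul]
      simp only [Matrix.neg_mul, Matrix.smul_mul, Matrix.one_mul]
      abel
    · simp
    · rw [mul_sub, neg_mul, neg_mul, Matrix.smul_mul, one_mul, smul_smul, mul_inv_cancel₀ hw0,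
        one_smul, Matrix.smul_mul, one_mul, smul_smul, mul_inv_cancel₀ hw0, one_smul, ← Matrix.mul_assoc]
      abel
  have htr : ∀ (a : Matrix k k ℂ) (b : Matrix k l ℂ) (c : Matrix l k ℂ) (d : Matrix l l ℂ),
      (Matrix.fromBlocks a b c d).trace = a.trace + d.trace := fun a b c d => by
    simp [Matrix.trace, Fintype.sum_sum_type]
  rw [hinv, htr, Matrix.trace_sub, Matrix.trace_smul, Matrix.trace_smul,
    Matrix.trace_smul, Matrix.trace_mul_comm (Yᴴ * R), ← Matrix.mul_assoc, hYR, Matrix.trace_add,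
    Matrix.trace_smul, Matrix.trace_one, Matrix.trace_one]
  simp only [smul_eq_mul, ← hwz]
  field_simp
  ring

/-- The block matrix is `V * M * Vᴴ` for the isometric embedding `V` of the first summand. -/
theorem norm_fromBlocks_left_le (M : Matrix k k ℂ) :
    ‖(Matrix.fromBlocks M 0 0 0 : Matrix (k ⊕ l) (k ⊕ l) ℂ)‖ ≤ ‖M‖ := by
  have h := Matrix.l2_opNorm_conjTranspose_mul_self
    (Matrix.fromRows 1 0 : Matrix (k ⊕ l) k ℂ)
  have h1 : (Matrix.fromRows 1 0 : Matrix (k ⊕ l) k ℂ)ᴴ *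
      (Matrix.fromRows 1 0 : Matrix (k ⊕ l) k ℂ) = 1 := by
    rw [Matrix.conjTranspose_fromRows_eq_fromCols_conjTranspose, Matrix.fromCols_mul_fromRows]
    simp
  have h2 : ‖(1 : Matrix k k ℂ)‖ ≤ 1 := by
    rw [← Matrix.diagonal_one, Matrix.l2_opNorm_diagonal, pi_norm_le_iff_of_nonneg zero_le_one]
    simp
  have h3 : ‖(Matrix.fromRows 1 0 : Matrix (k ⊕ l) k ℂ)‖ ≤ 1 := by
    rw [h1] at h
    nlinarith [norm_nonneg (Matrix.fromRows 1 0 : Matrix (k ⊕ l) k ℂ)]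
  have e : (Matrix.fromBlocks M 0 0 0 : Matrix (k ⊕ l) (k ⊕ l) ℂ) =
      (Matrix.fromRows 1 0 : Matrix (k ⊕ l) k ℂ) * M * (Matrix.fromRows 1 0 : Matrix (k ⊕ l) k ℂ)ᴴ := by
    rw [Matrix.conjTranspose_fromRows_eq_fromCols_conjTranspose, Matrix.fromRows_mul,
      Matrix.fromRows_mul_fromCols]
    simp
  rw [e]
  refine (Matrix.l2_opNorm_mul _ _).trans ?_
  rw [Matrix.l2_opNorm_conjTranspose]
  refine (mul_le_of_le_one_right (norm_nonneg _) h3).trans ((Matrix.l2_opNorm_mul _ _).trans ?_)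
  exact mul_le_of_le_one_left (norm_nonneg _) h3

theorem norm_fromBlocks_right_le (M : Matrix l l ℂ) :
    ‖(Matrix.fromBlocks 0 0 0 M : Matrix (k ⊕ l) (k ⊕ l) ℂ)‖ ≤ ‖M‖ := by
  have h := Matrix.l2_opNorm_conjTranspose_mul_self
    (Matrix.fromRows 0 1 : Matrix (k ⊕ l) l ℂ)
  have h1 : (Matrix.fromRows 0 1 : Matrix (k ⊕ l) l ℂ)ᴴ *
      (Matrix.fromRows 0 1 : Matrix (k ⊕ l) l ℂ) = 1 := by
    rw [Matrix.conjTranspose_fromRows_eq_fromCols_conjTranspose, Matrix.fromCols_mul_fromRows]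
    simp
  have h2 : ‖(1 : Matrix l l ℂ)‖ ≤ 1 := by
    rw [← Matrix.diagonal_one, Matrix.l2_opNorm_diagonal, pi_norm_le_iff_of_nonneg zero_le_one]
    simp
  have h3 : ‖(Matrix.fromRows 0 1 : Matrix (k ⊕ l) l ℂ)‖ ≤ 1 := by
    rw [h1] at h
    nlinarith [norm_nonneg (Matrix.fromRows 0 1 : Matrix (k ⊕ l) l ℂ)]
  have e : (Matrix.fromBlocks 0 0 0 M : Matrix (k ⊕ l) (k ⊕ l) ℂ) =
      (Matrix.fromRows 0 1 : Matrix (k ⊕ l) l ℂ) * M * (Matrix.fromRows 0 1 : Matrix (k ⊕ l) l ℂ)ᴴ := by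
    rw [Matrix.conjTranspose_fromRows_eq_fromCols_conjTranspose, Matrix.fromRows_mul,
      Matrix.fromRows_mul_fromCols]
    simp
  rw [e]
  refine (Matrix.l2_opNorm_mul _ _).trans ?_
  rw [Matrix.l2_opNorm_conjTranspose]
  refine (mul_le_of_le_one_right (norm_nonneg _) h3).trans ((Matrix.l2_opNorm_mul _ _).trans ?_)
  exact mul_le_of_le_one_left (norm_nonneg _) h3

theorem norm_sqrt_le {n : ℕ} {A : Matrix (Fin n) (Fin n) ℂ} (hA : A.PosSemidef) {τ : ℝ}
    (hτ : opNorm A ≤ τ) : ‖CFC.sqrt A‖ ≤ √τ := by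
  have h1 : (CFC.sqrt A)ᴴ * CFC.sqrt A = A := by
    have hs : (CFC.sqrt A)ᴴ = CFC.sqrt A := (CFC.sqrt_nonneg A).isSelfAdjoint
    rw [hs, CFC.sqrt_mul_sqrt_self A (Matrix.nonneg_iff_posSemidef.2 hA)]
  have h2 := Matrix.l2_opNorm_conjTranspose_mul_self (CFC.sqrt A)
  rw [h1] at h2
  refine Real.le_sqrt_of_sq_le ?_
  rw [sq, ← h2]
  rwa [opNorm, Matrix.l2_opNorm_toEuclideanCLM] at hτ

/-- The coefficient of the innovation `(r, i, j)` in the Hermitization of the data matrix. -/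
noncomputable def innovationCoeff {K p n : ℕ} (A : Fin K → Matrix (Fin p) (Fin p) ℂ)
    (B : Fin K → Matrix (Fin n) (Fin n) ℂ) (q : Fin K × Fin p × Fin n) :
    Matrix (Fin p ⊕ Fin n) (Fin p ⊕ Fin n) ℂ :=
  Matrix.fromBlocks (CFC.sqrt (A q.1)) 0 0 0 * Matrix.single (Sum.inl q.2.1) (Sum.inr q.2.2) 1 *
    Matrix.fromBlocks 0 0 0 (CFC.sqrt (B q.1))

/-- The innovation matrices with entries `x (r, i, j)`. -/
def toInnovations {K p n : ℕ} (x : Fin K × Fin p × Fin n → ℂ) :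
    Fin K → Matrix (Fin p) (Fin n) ℂ := fun r => Matrix.of fun i j => x (r, i, j)

section

variable {K p n : ℕ} (A : Fin K → Matrix (Fin p) (Fin p) ℂ)
  (B : Fin K → Matrix (Fin n) (Fin n) ℂ)

theorem innovationCoeff_eq_fromBlocks (q : Fin K × Fin p × Fin n) :
    innovationCoeff A B q = Matrix.fromBlocks 0
      (CFC.sqrt (A q.1) * Matrix.single q.2.1 q.2.2 (1 : ℂ) * CFC.sqrt (B q.1)) 0 0 := by
  have : (Matrix.single (Sum.inl q.2.1) (Sum.inr q.2.2) 1 :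
      Matrix (Fin p ⊕ Fin n) (Fin p ⊕ Fin n) ℂ) =
      Matrix.fromBlocks 0 (Matrix.single q.2.1 q.2.2 1) 0 0 := by
    ext i j
    rcases i with i | i <;> rcases j with j | j <;> simp [Matrix.single_apply]
  rw [innovationCoeff, this, Matrix.fromBlocks_multiply, Matrix.fromBlocks_multiply]
  simp

theorem sum_smul_innovationCoeff (x : Fin K × Fin p × Fin n → ℂ) :
    ∑ q, x q • innovationCoeff A B q =
      Matrix.fromBlocks 0 (dataMatrix A B (toInnovations x)) 0 0 := by
  have h : dataMatrix A B (toInnovations x) = ∑ q : Fin K × Fin p × Fin n,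
      x q • (CFC.sqrt (A q.1) * Matrix.single q.2.1 q.2.2 (1 : ℂ) * CFC.sqrt (B q.1)) := by
    rw [dataMatrix, Fintype.sum_prod_type]
    refine Finset.sum_congr rfl fun r _ => ?_
    rw [Fintype.sum_prod_type, Matrix.matrix_eq_sum_single (toInnovations x r), Matrix.mul_sum,
      Matrix.sum_mul]
    refine Finset.sum_congr rfl fun i _ => ?_
    rw [Matrix.mul_sum, Matrix.sum_mul]
    refine Finset.sum_congr rfl fun j _ => ?_
    have e : Matrix.single i j (toInnovations x r i j) = x (r, i, j) • Matrix.single i j (1 : ℂ) := by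
      rw [Matrix.smul_single, smul_eq_mul, mul_one]
      rfl
    rw [e, Matrix.mul_smul, Matrix.smul_mul]
  rw [h]
  simp only [innovationCoeff_eq_fromBlocks, Matrix.fromBlocks_smul, smul_zero]
  ext i j
  rcases i with i | i <;> rcases j with j | j <;> simp [Matrix.sum_apply]

theorem hermSum_innovationCoeff (s : ℝ) (x : Fin K × Fin p × Fin n → ℂ) :
    hermSum (innovationCoeff A B) s x =
      Matrix.fromBlocks 0 ((s : ℂ) • dataMatrix A B (toInnovations x))
        ((s : ℂ) • dataMatrix A B (toInnovations x))ᴴ 0 := by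
  have h := sum_smul_innovationCoeff A B x
  have e : hermSum (innovationCoeff A B) s x = (s : ℂ) • ∑ q, x q • innovationCoeff A B q +
      ((s : ℂ) • ∑ q, x q • innovationCoeff A B q)ᴴ := by
    unfold hermSum hermPerturb
    rw [Finset.sum_add_distrib, Matrix.conjTranspose_smul, Matrix.conjTranspose_sum,
      Finset.smul_sum, Finset.smul_sum]
    simp only [Matrix.conjTranspose_smul, smul_smul]
    simp
  rw [e, h, Matrix.fromBlocks_smul, Matrix.fromBlocks_conjTranspose, Matrix.fromBlocks_add]
  simp

theorem stieltjes_sampleCov_eq {z w : ℂ} (hz : 0 < z.im) (hwz : w * w = z)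
    (x : Fin K × Fin p × Fin n → ℂ) :
    stieltjes (sampleCov A B (toInnovations x)) z = (1 / (2 * w * p)) *
      (resolvMatrix (hermSum (innovationCoeff A B) (√n)⁻¹ x) w).trace -
        (1 / (2 * w * p)) * (((p : ℂ) - n) / w) := by
  have hw0 : w ≠ 0 := by
    rintro rfl
    simp [← hwz] at hz
  have hS : sampleCov A B (toInnovations x) =
      ((((√n)⁻¹ : ℝ) : ℂ) • dataMatrix A B (toInnovations x)) *
      ((((√n)⁻¹ : ℝ) : ℂ) • dataMatrix A B (toInnovations x))ᴴ := by
    rw [sampleCov, Matrix.conjTranspose_smul, Matrix.smul_mul, Matrix.mul_smul, smul_smul]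
    congr 1
    rw [Complex.star_def, Complex.conj_ofReal, ← Complex.ofReal_mul, ← mul_inv,
      Real.mul_self_sqrt (Nat.cast_nonneg n)]
    simp
  rw [hermSum_innovationCoeff, trace_resolvMatrix_fromBlocks _ hz hwz, ← hS, stieltjes,
    resolvMatrix]
  simp only [Fintype.card_fin]
  -- For `p = 0` both sides vanish, since `1 / p` is then `0`.
  rcases Nat.eq_zero_or_pos p with rfl | hp
  · simp
  have hp0 : (p : ℂ) ≠ 0 := by exact_mod_cast hp.ne'
  field_simp
  ring

variable {A B} {τ : ℝ} (hA : ∀ r, (A r).PosSemidef) (hB : ∀ r, (B r).PosSemidef)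
  (hAτ : ∀ r, opNorm (A r) ≤ τ) (hBτ : ∀ r, opNorm (B r) ≤ τ)

include hA hB hAτ hBτ

theorem norm_mul_norm_blocks_le (hτ : 0 ≤ τ) (r : Fin K) :
    ‖(Matrix.fromBlocks (CFC.sqrt (A r)) 0 0 0 : Matrix (Fin p ⊕ Fin n) (Fin p ⊕ Fin n) ℂ)‖ *
    ‖(Matrix.fromBlocks 0 0 0 (CFC.sqrt (B r)) : Matrix (Fin p ⊕ Fin n) (Fin p ⊕ Fin n) ℂ)‖ ≤
      τ := by
  rw [← Real.mul_self_sqrt hτ]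
  exact mul_le_mul ((norm_fromBlocks_left_le _).trans (norm_sqrt_le (hA r) (hAτ r)))
    ((norm_fromBlocks_right_le _).trans (norm_sqrt_le (hB r) (hBτ r))) (norm_nonneg _)
    (Real.sqrt_nonneg _)

theorem traceNormLE_innovationCoeff (hτ : 0 ≤ τ) (q : Fin K × Fin p × Fin n) :
    TraceNormLE (innovationCoeff A B q) τ :=
  TraceNormLE.mul_single_mul _ _ _ _ (norm_mul_norm_blocks_le hA hB hAτ hBτ hτ q.1)

theorem sum_norm_trace_innovationCoeff_le (hτ : 0 ≤ τ) {g : ℝ}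
    {G : Matrix (Fin p ⊕ Fin n) (Fin p ⊕ Fin n) ℂ} (hG : ‖G‖ ≤ g) :
    ∑ q, (‖(G * innovationCoeff A B q * G * innovationCoeff A B q * G).trace‖ +
      ‖(G * (innovationCoeff A B q)ᴴ * G * (innovationCoeff A B q)ᴴ * G).trace‖) ≤
      K * (p + n) * (((τ * g) ^ 2 + (τ * g ^ 2) ^ 2) / 2) := by
  have hg : 0 ≤ g := (norm_nonneg _).trans hG
  have hGG : ‖G * G‖ ≤ g ^ 2 := by
    rw [sq]
    exact (norm_mul_le _ _).trans (mul_le_mul hG hG (norm_nonneg _) hg)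
  have key : ∀ (P Q M : Matrix (Fin p ⊕ Fin n) (Fin p ⊕ Fin n) ℂ) (t : ℝ),
      ‖P‖ * ‖Q‖ ≤ τ → ‖M‖ ≤ t → ‖P * M * Q‖ ^ 2 ≤ (τ * t) ^ 2 := by
    intro P Q M t h1 h2
    refine pow_le_pow_left₀ (norm_nonneg _) ?_ 2
    calc ‖P * M * Q‖ ≤ ‖P‖ * ‖M‖ * ‖Q‖ :=
          (norm_mul_le _ _).trans (mul_le_mul_of_nonneg_right (norm_mul_le _ _) (norm_nonneg _))
      _ = (‖P‖ * ‖Q‖) * ‖M‖ := by ring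
      _ ≤ τ * t := mul_le_mul h1 h2 (norm_nonneg _) hτ
  -- An off-diagonal block is summed column by column: `p` columns for one block, `n` for the other.
  -- Hence the factor `p + n` where a termwise bound would give `p * n`.
  have colL : ∀ (M : Matrix (Fin p ⊕ Fin n) (Fin p ⊕ Fin n) ℂ) (t : ℝ), ‖M‖ ^ 2 ≤ t →
      ∑ i : Fin p, ∑ j : Fin n, ‖M (Sum.inr j) (Sum.inl i)‖ ^ 2 ≤ p * t := by
    intro M t ht
    refine (Finset.sum_le_sum fun i _ => (?_ : _ ≤ t)).trans (le_of_eq (by simp))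
    refine le_trans ?_ ((sum_sq_norm_col_le M (Sum.inl i)).trans ht)
    rw [Fintype.sum_sum_type]
    exact le_add_of_nonneg_left (Finset.sum_nonneg fun _ _ => sq_nonneg _)
  have colR : ∀ (M : Matrix (Fin p ⊕ Fin n) (Fin p ⊕ Fin n) ℂ) (t : ℝ), ‖M‖ ^ 2 ≤ t →
      ∑ i : Fin p, ∑ j : Fin n, ‖M (Sum.inl i) (Sum.inr j)‖ ^ 2 ≤ n * t := by
    intro M t ht
    rw [Finset.sum_comm]
    refine (Finset.sum_le_sum fun j _ => (?_ : _ ≤ t)).trans (le_of_eq (by simp))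
    refine le_trans ?_ ((sum_sq_norm_col_le M (Sum.inr j)).trans ht)
    rw [Fintype.sum_sum_type]
    exact le_add_of_nonneg_right (Finset.sum_nonneg fun _ _ => sq_nonneg _)
  rw [Fintype.sum_prod_type]
  refine (Finset.sum_le_sum fun r _ =>
    (?_ : _ ≤ (p + n) * (((τ * g) ^ 2 + (τ * g ^ 2) ^ 2) / 2))).trans
    (le_of_eq (by simp [mul_assoc]))
  rw [Fintype.sum_prod_type]
  have hAB := norm_mul_norm_blocks_le hA hB hAτ hBτ hτ r
  have hco : ∀ i j, innovationCoeff A B (r, i, j) = Matrix.fromBlocks (CFC.sqrt (A r)) 0 0 0 *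
      Matrix.single (Sum.inl i) (Sum.inr j) 1 * Matrix.fromBlocks 0 0 0 (CFC.sqrt (B r)) :=
    fun _ _ => rfl
  set P : Matrix (Fin p ⊕ Fin n) (Fin p ⊕ Fin n) ℂ := Matrix.fromBlocks (CFC.sqrt (A r)) 0 0 0
  set Q : Matrix (Fin p ⊕ Fin n) (Fin p ⊕ Fin n) ℂ := Matrix.fromBlocks 0 0 0 (CFC.sqrt (B r))
  have hcoH : ∀ i j, (innovationCoeff A B (r, i, j))ᴴ =
      Qᴴ * Matrix.single (Sum.inr j) (Sum.inl i) 1 * Pᴴ := by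
    intro i j
    rw [hco, Matrix.conjTranspose_mul, Matrix.conjTranspose_mul, Matrix.conjTranspose_single,
      star_one, mul_assoc]
  have hBA : ‖Q‖ * ‖P‖ ≤ τ := by rwa [mul_comm]
  have hAB' : ‖Pᴴ‖ * ‖Qᴴ‖ ≤ τ := by
    rwa [Matrix.l2_opNorm_conjTranspose, Matrix.l2_opNorm_conjTranspose]
  have c1 := colL _ _ (key Q P G g hBA hG)
  have c2 := colL _ _ (key Q P (G * G) (g ^ 2) hBA hGG)
  have c3 := colR _ _ (key Pᴴ Qᴴ G g hAB' hG)
  have c4 := colR _ _ (key Pᴴ Qᴴ (G * G) (g ^ 2) hAB' hGG)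
  have step : ∀ i j, ‖(G * innovationCoeff A B (r, i, j) * G * innovationCoeff A B (r, i, j) *
      G).trace‖ + ‖(G * (innovationCoeff A B (r, i, j))ᴴ * G * (innovationCoeff A B (r, i, j))ᴴ *
      G).trace‖ ≤ (‖(Q * G * P) (Sum.inr j) (Sum.inl i)‖ ^ 2 +
        ‖(Q * (G * G) * P) (Sum.inr j) (Sum.inl i)‖ ^ 2 +
        (‖(Pᴴ * G * Qᴴ) (Sum.inl i) (Sum.inr j)‖ ^ 2 +
        ‖(Pᴴ * (G * G) * Qᴴ) (Sum.inl i) (Sum.inr j)‖ ^ 2)) / 2 := by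
    intro i j
    rw [hcoH, hco, add_div]
    exact add_le_add (norm_trace_mul_single_sq_le _ _ _ _ _) (norm_trace_mul_single_sq_le _ _ _ _ _)
  refine (Finset.sum_le_sum fun i _ => Finset.sum_le_sum fun j _ => step i j).trans ?_
  simp only [← Finset.sum_div, Finset.sum_add_distrib]
  linarith

/-- Comparison of expected Stieltjes transforms for two families of independent innovations. -/
theorem norm_integral_stieltjes_sub_le (hτ : 0 ≤ τ)
    {μ ν : Fin K × Fin p × Fin n → Measure ℂ} [∀ q, IsProbabilityMeasure (μ q)]
    [∀ q, IsProbabilityMeasure (ν q)] {ε₁ ε₂ L : ℝ} (hε₂ : 0 ≤ ε₂)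
    (hμ : ∀ q, IsNearStandard (μ q) ε₁ ε₂ L) (hν : ∀ q, IsNearStandard (ν q) ε₁ ε₂ L)
    {z w : ℂ} (hz : 0 < z.im) (hw : 0 < w.im) (hwz : w * w = z) :
    ‖∫ x, stieltjes (sampleCov A B (toInnovations x)) z ∂Measure.pi μ -
      ∫ x, stieltjes (sampleCov A B (toInnovations x)) z ∂Measure.pi ν‖ ≤
      1 / (2 * ‖w‖ * p) * (2 * (1 + ε₂) * (((√n)⁻¹) ^ 2 *
        (K * (p + n) * (((τ * w.im⁻¹) ^ 2 + (τ * w.im⁻¹ ^ 2) ^ 2) / 2)) *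
        harmonic (K * (p * n))) + (K * (p * n)) *
      (2 * ε₁ * (2 * (√n)⁻¹ * τ * w.im⁻¹ ^ 2) +
        2 * ε₂ * (2 * (√n)⁻¹ ^ 2 * τ ^ 2 * w.im⁻¹ ^ 3) +
        2 * (1 + ε₂) * ((12 * (√n)⁻¹ ^ 3 * τ ^ 3 * w.im⁻¹ ^ 4) * (1 + L)) +
        2 * (12 * (√n)⁻¹ ^ 3 * τ ^ 3 * w.im⁻¹ ^ 4) * L)) := by
  have hm := norm_integral_trace_resolvMatrix_sub_le hε₂ hμ hν
    (traceNormLE_innovationCoeff hA hB hAτ hBτ hτ) (s := (√n)⁻¹) (by positivity) hw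
    (fun G hG => sum_norm_trace_innovationCoeff_le hA hB hAτ hBτ hτ hG)
  have hint : ∀ (ρ : Fin K × Fin p × Fin n → Measure ℂ) [∀ q, IsProbabilityMeasure (ρ q)],
      Integrable (fun x => (resolvMatrix (hermSum (innovationCoeff A B) (√n)⁻¹ x) w).trace)
        (Measure.pi ρ) := fun ρ _ =>
    Integrable.of_bound
      (continuous_resolvMatrix_hermSum _ _ hw).matrix_trace.aestronglyMeasurable
      (Fintype.card (Fin p ⊕ Fin n) * w.im⁻¹) (ae_of_all _ fun x => (norm_trace_le _).trans
        (mul_le_mul_of_nonneg_left (norm_resolvMatrix_le (isHermitian_hermSum _ _ x) hw)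
          (Nat.cast_nonneg _)))
  simp only [stieltjes_sampleCov_eq A B hz hwz]
  have he : ∀ (ρ : Fin K × Fin p × Fin n → Measure ℂ) [∀ q, IsProbabilityMeasure (ρ q)],
      ∫ x, (1 / (2 * w * p) * (resolvMatrix (hermSum (innovationCoeff A B) (√n)⁻¹ x) w).trace -
        1 / (2 * w * p) * (((p : ℂ) - n) / w)) ∂Measure.pi ρ = 1 / (2 * w * p) *
      ∫ x, (resolvMatrix (hermSum (innovationCoeff A B) (√n)⁻¹ x) w).trace ∂Measure.pi ρ -
        1 / (2 * w * p) * (((p : ℂ) - n) / w) := by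
    intro ρ _
    rw [integral_sub ((hint ρ).const_mul _) (integrable_const _), integral_const_mul,
      integral_const, probReal_univ, one_smul]
  -- The shift by `(p - n) / w` is deterministic and cancels.
  rw [he μ, he ν, sub_sub_sub_cancel_right, ← mul_sub, norm_mul]
  refine mul_le_mul (le_of_eq (by simp)) (hm.trans (le_of_eq ?_)) (norm_nonneg _) (by positivity)
  simp

end

end Linearization

/-! ### Moment bounds and truncation -/

/-- The scalar truncation at level `b`. -/
noncomputable def truncAt (b : ℝ) (w : ℂ) : ℂ := if ‖w‖ ≤ b then w else 0

theorem measurable_truncAt (b : ℝ) : Measurable (truncAt b) :=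
  Measurable.ite (measurableSet_le measurable_norm measurable_const) measurable_id measurable_const

theorem norm_truncAt_le (b : ℝ) (w : ℂ) : ‖truncAt b w‖ ≤ ‖w‖ := by
  unfold truncAt
  split_ifs <;> simp

/-- Markov-type tail trade: above level `b`, a lower power costs a negative power of `b` times the
`t`-th power. -/
theorem rpow_le_mul_rpow_of_le {b y k t : ℝ} (hb : 0 < b) (hy : b ≤ y) (hk : k ≤ t) :
    y ^ k ≤ b ^ (k - t) * y ^ t := by
  have hy0 : 0 < y := hb.trans_le hy
  have e : y ^ k = y ^ (k - t) * y ^ t := by rw [← Real.rpow_add hy0]; ring_nf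
  rw [e]
  refine mul_le_mul_of_nonneg_right ?_ (by positivity)
  exact Real.rpow_le_rpow_of_nonpos hb hy (by linarith)

theorem cube_le_one_add_rpow {y t : ℝ} (hy : 0 ≤ y) (ht : 3 ≤ t) : y ^ 3 ≤ 1 + y ^ t := by
  rcases le_total y 1 with h | h
  · have : y ^ 3 ≤ 1 := pow_le_one₀ hy h
    have := Real.rpow_nonneg hy t
    linarith
  · have := Real.rpow_le_rpow_of_exponent_le h ht
    rw [show (3 : ℝ) = ((3 : ℕ) : ℝ) by norm_num, Real.rpow_natCast] at this
    linarith

/-- A centred law with unit second absolute moment. -/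
structure IsStandardLaw (μ : Measure ℂ) : Prop where
  mean : ∫ h, h ∂μ = 0
  var : ∫ h, ‖h‖ ^ 2 ∂μ = 1

namespace IsStandardLaw

variable {μ : Measure ℂ}

theorem isNearStandard [IsProbabilityMeasure μ] (hμ : IsStandardLaw μ) {t M : ℝ} (ht : 3 ≤ t)
    (hi : Integrable (fun h : ℂ => ‖h‖ ^ t) μ) (hM : ∫ h : ℂ, ‖h‖ ^ t ∂μ ≤ M) :
    IsNearStandard μ 0 0 (1 + M) := by
  have hi' : Integrable (fun h : ℂ => 1 + ‖h‖ ^ t) μ := (integrable_const 1).add hi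
  have h3 : Integrable (fun h : ℂ => ‖h‖ ^ 3) μ :=
    hi'.mono' (by fun_prop) (ae_of_all _ fun h => by
      rw [Real.norm_of_nonneg (by positivity)]
      exact cube_le_one_add_rpow (norm_nonneg h) ht)
  refine ⟨h3, by simp [hμ.mean], by simp [hμ.var], ?_⟩
  have := integral_mono h3 hi' fun h => cube_le_one_add_rpow (norm_nonneg h) ht
  rw [integral_add (integrable_const 1) hi] at this
  simp at this
  linarith

/-- Uses `‖h‖ ^ 3 ≤ b * ‖h‖ ^ 2`; the mean and variance stay exact and no higher moment is needed.
-/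
theorem isNearStandard_of_bounded (hμ : IsStandardLaw μ) {b : ℝ} (hb : ∀ᵐ h ∂μ, ‖h‖ ≤ b) :
    IsNearStandard μ 0 0 b := by
  -- The integral of a non-integrable function is `0` by convention, which `var` rules out.
  have i2 : Integrable (fun h : ℂ => ‖h‖ ^ 2) μ := by
    by_contra hcon
    have := hμ.var
    rw [integral_undef hcon] at this
    simp at this
  have hle : ∀ᵐ h : ℂ ∂μ, ‖h‖ ^ 3 ≤ b * ‖h‖ ^ 2 := hb.mono fun h hh => by
    rw [pow_succ, mul_comm]
    exact mul_le_mul_of_nonneg_right hh (by positivity)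
  have h3 : Integrable (fun h : ℂ => ‖h‖ ^ 3) μ :=
    (i2.const_mul b).mono' (by fun_prop) (hle.mono fun h hh => by
      rwa [Real.norm_of_nonneg (by positivity)])
  refine ⟨h3, by simp [hμ.mean], by simp [hμ.var], ?_⟩
  have := integral_mono_ae h3 (i2.const_mul b) hle
  rwa [integral_const_mul, hμ.var, mul_one] at this

/-- Truncation changes `h` only where `‖h‖ > b`, so the errors in the first two moments are tail
integrals bounded by the `t`-th moment. -/
theorem isNearStandard_map_truncAt [IsProbabilityMeasure μ] (hμ : IsStandardLaw μ) {t M b : ℝ}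
    (ht : 3 ≤ t) (hb : 0 < b)
    (hi : Integrable (fun h : ℂ => ‖h‖ ^ t) μ) (hM : ∫ h : ℂ, ‖h‖ ^ t ∂μ ≤ M) :
    IsNearStandard (μ.map (truncAt b)) (M * b ^ (1 - t)) (M * b ^ (2 - t)) (1 + M) := by
  have hs := hμ.isNearStandard ht hi hM
  have hm := measurable_truncAt b
  have i1 : Integrable (fun h : ℂ => h) μ := (integrable_norm_iff (by fun_prop)).1 hs.integrable_norm
  have i1' : Integrable (truncAt b) μ :=
    hs.integrable_norm.mono' hm.aestronglyMeasurable (ae_of_all _ (norm_truncAt_le b))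
  have i2' : Integrable (fun h => ‖truncAt b h‖ ^ 2) μ :=
    hs.integrable_sq.mono' (hm.norm.pow_const 2).aestronglyMeasurable (ae_of_all _ fun h => by
      rw [Real.norm_of_nonneg (by positivity)]
      exact pow_le_pow_left₀ (norm_nonneg _) (norm_truncAt_le b h) 2)
  have i3' : Integrable (fun h => ‖truncAt b h‖ ^ 3) μ :=
    hs.integrable.mono' (hm.norm.pow_const 3).aestronglyMeasurable (ae_of_all _ fun h => by
      rw [Real.norm_of_nonneg (by positivity)]
      exact pow_le_pow_left₀ (norm_nonneg _) (norm_truncAt_le b h) 3)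
  refine ⟨(integrable_map_measure (by fun_prop) hm.aemeasurable).2 i3', ?_, ?_, ?_⟩
  · rw [integral_map hm.aemeasurable (by fun_prop)]
    have e : ∫ h, truncAt b h ∂μ = ∫ h, (truncAt b h - h) ∂μ := by
      rw [integral_sub i1' i1, hμ.mean, sub_zero]
    rw [e]
    refine (norm_integral_le_of_norm_le (hi.const_mul (b ^ (1 - t))) (ae_of_all _ fun h => ?_)).trans
      ?_
    · unfold truncAt
      split_ifs with hh
      · simp; positivity
      · have := rpow_le_mul_rpow_of_le hb (not_le.1 hh).le (by linarith : (1 : ℝ) ≤ t)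
        simpa using this
    · rw [integral_const_mul, mul_comm]
      exact mul_le_mul_of_nonneg_right hM (by positivity)
  · rw [integral_map hm.aemeasurable (by fun_prop), ← hμ.var, ← integral_sub i2' hs.integrable_sq,
      ← Real.norm_eq_abs]
    refine (norm_integral_le_of_norm_le (hi.const_mul (b ^ (2 - t))) (ae_of_all _ fun h => ?_)).trans
      ?_
    · unfold truncAt
      split_ifs with hh
      · simp; positivity
      · have := rpow_le_mul_rpow_of_le hb (not_le.1 hh).le (by linarith : (2 : ℝ) ≤ t)
        simpa using this
    · rw [integral_const_mul, mul_comm]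
      exact mul_le_mul_of_nonneg_right hM (by positivity)
  · rw [integral_map hm.aemeasurable (by fun_prop)]
    refine le_trans (integral_mono i3' hs.integrable fun h => ?_) hs.third
    exact pow_le_pow_left₀ (norm_nonneg _) (norm_truncAt_le b h) 3

end IsStandardLaw

/-! ### The standard complex Gaussian law -/

section Gaussian

theorem measurable_toComplex : Measurable fun x : ℝ × ℝ => (x.1 : ℂ) + (x.2 : ℂ) * Complex.I := by
  fun_prop

instance : IsProbabilityMeasure stdComplexGaussian :=
  Measure.isProbabilityMeasure_map measurable_toComplex.aemeasurable

theorem memLp_toComplex (q : ENNReal) (hq : q ≠ ⊤) :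
    MemLp (fun x : ℝ × ℝ => (x.1 : ℂ) + (x.2 : ℂ) * Complex.I) q
      ((gaussianReal 0 (1 / 2)).prod (gaussianReal 0 (1 / 2))) := by
  have h1 : MemLp (fun x : ℝ => (x : ℂ)) q (gaussianReal 0 (1 / 2)) :=
    (memLp_id_gaussianReal' q hq).ofReal
  have h2 : MemLp (fun x : ℝ => (x : ℂ) * Complex.I) q (gaussianReal 0 (1 / 2)) := h1.mul_const _
  exact (h1.comp_fst _).add (h2.comp_snd _)

theorem integrable_rpow_stdComplexGaussian {t : ℝ} (ht : 0 < t) :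
    Integrable (fun h : ℂ => ‖h‖ ^ t) stdComplexGaussian := by
  have h := (memLp_toComplex (ENNReal.ofReal t) (by simp)).integrable_norm_rpow
    (by simpa using ht) (by simp)
  rw [ENNReal.toReal_ofReal ht.le] at h
  rw [stdComplexGaussian, integrable_map_measure
    (measurable_norm.pow_const t).aestronglyMeasurable measurable_toComplex.aemeasurable]
  exact h

theorem isStandardLaw_stdComplexGaussian : IsStandardLaw stdComplexGaussian := by
  have i1 : Integrable (fun x : ℝ => x) (gaussianReal 0 (1 / 2)) :=
    (memLp_id_gaussianReal 1).integrable (by norm_num)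
  have i2 : Integrable (fun x : ℝ => x ^ 2) (gaussianReal 0 (1 / 2)) :=
    (memLp_id_gaussianReal 2).integrable_sq
  have m2 : ∫ x : ℝ, x ^ 2 ∂gaussianReal 0 (1 / 2) = 1 / 2 := by
    have := variance_of_integral_eq_zero (μ := gaussianReal 0 (1 / 2)) (X := id)
      aemeasurable_id (by simp)
    simp only [variance_id_gaussianReal, id] at this
    rw [← this]; simp
  refine ⟨?_, ?_⟩
  · rw [stdComplexGaussian, integral_map measurable_toComplex.aemeasurable (by fun_prop)]
    have j1 : Integrable (fun x : ℝ × ℝ => (x.1 : ℂ))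
      ((gaussianReal 0 (1 / 2)).prod (gaussianReal 0 (1 / 2))) := i1.ofReal.comp_fst _
    have j2 : Integrable (fun x : ℝ × ℝ => (x.2 : ℂ) * Complex.I)
      ((gaussianReal 0 (1 / 2)).prod (gaussianReal 0 (1 / 2))) :=
        (i1.ofReal.comp_snd (gaussianReal 0 (1 / 2))).mul_const Complex.I
    rw [integral_add j1 j2, integral_mul_const, integral_complex_ofReal, integral_complex_ofReal,
      integral_fun_fst (fun x : ℝ => x), integral_fun_snd (fun x : ℝ => x)]
    simp
  · rw [stdComplexGaussian, integral_map measurable_toComplex.aemeasurable (by fun_prop)]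
    have e : ∀ x : ℝ × ℝ, ‖(x.1 : ℂ) + (x.2 : ℂ) * Complex.I‖ ^ 2 = x.1 ^ 2 + x.2 ^ 2 := fun x => by
      rw [Complex.norm_add_mul_I, Real.sq_sqrt (by positivity)]
    simp only [e]
    rw [integral_add (i2.comp_fst _) (i2.comp_snd _), integral_fun_fst (fun x : ℝ => x ^ 2),
      integral_fun_snd (fun x : ℝ => x ^ 2), m2]
    simp
    norm_num

end Gaussian

/-! ### Asymptotics of the error bound -/

/-- `harmonic N ≤ 1 + log N`, and `log N = log K + log (p / n) + 2 * log n` is `o(n)`. -/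
theorem tendsto_harmonic_div_atTop (K : ℕ) {p : ℕ → ℕ} {c : ℝ} (hc : 0 < c)
    (hp : Tendsto (fun n : ℕ => (p n : ℝ) / (n : ℝ)) atTop (𝓝 c)) :
    Tendsto (fun n : ℕ => (harmonic (K * (p n * n)) : ℝ) / n) atTop (𝓝 0) := by
  rcases Nat.eq_zero_or_pos K with rfl | hK
  · simp
  have hinv : Tendsto (fun n : ℕ => 1 / (n : ℝ)) atTop (𝓝 0) := tendsto_one_div_atTop_nhds_zero_nat
  have hlog : Tendsto (fun n : ℕ => Real.log n / (n : ℝ)) atTop (𝓝 0) := by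
    exact Real.isLittleO_log_id_atTop.tendsto_div_nhds_zero.comp
      (tendsto_natCast_atTop_atTop (R := ℝ))
  have hpl : Tendsto (fun n : ℕ => Real.log ((p n : ℝ) / n)) atTop (𝓝 (Real.log c)) :=
    (Real.continuousAt_log hc.ne').tendsto.comp hp
  have hub : Tendsto (fun n : ℕ => (1 + Real.log K + Real.log ((p n : ℝ) / n)) * (1 / (n : ℝ)) +
      2 * (Real.log n / (n : ℝ))) atTop (𝓝 0) := by
    simpa using ((hpl.const_add (1 + Real.log K)).mul hinv).add (hlog.const_mul 2)
  refine tendsto_of_tendsto_of_tendsto_of_le_of_le' tendsto_const_nhds hub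
    (Eventually.of_forall fun n => ?_) ?_
  · have : (0 : ℝ) ≤ harmonic (K * (p n * n)) := by
      rw [harmonic]; push_cast; positivity
    positivity
  · filter_upwards [hp.eventually_const_lt hc, eventually_gt_atTop 0] with n h1 h2
    have hn : (0 : ℝ) < n := by exact_mod_cast h2
    have hpn : (0 : ℝ) < p n := by
      by_contra h
      exact absurd h1 (not_lt.2 (div_nonpos_of_nonpos_of_nonneg (not_lt.1 h) hn.le))
    have hKr : (0 : ℝ) < K := by exact_mod_cast hK
    have h := harmonic_le_one_add_log (K * (p n * n))
    have e : Real.log ((K * (p n * n) : ℕ) : ℝ) =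
        Real.log K + (Real.log ((p n : ℝ) / n) + 2 * Real.log n) := by
      push_cast
      rw [Real.log_mul hKr.ne' (by positivity), Real.log_mul hpn.ne' hn.ne',
        Real.log_div hpn.ne' hn.ne']
      ring
    rw [e] at h
    calc (harmonic (K * (p n * n)) : ℝ) / n ≤
        (1 + (Real.log K + (Real.log ((p n : ℝ) / n) + 2 * Real.log n))) / n := by gcongr
      _ = _ := by ring

theorem exists_sqrt_im_pos {z : ℂ} (hz : 0 < z.im) : ∃ w : ℂ, 0 < w.im ∧ w * w = z := by
  obtain ⟨w, hw⟩ := IsAlgClosed.exists_eq_mul_self z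
  rcases lt_trichotomy w.im 0 with h | h | h
  · exact ⟨-w, by simpa using h, by rw [neg_mul_neg, hw]⟩
  · simp [hw, h] at hz
  · exact ⟨w, h, hw.symm⟩

section Asymptotics

variable {K : ℕ} {p : ℕ → ℕ} {c : ℝ} (hc : 0 < c)
  (hp : Tendsto (fun n : ℕ => (p n : ℝ) / (n : ℝ)) atTop (𝓝 c))
  {A : (n : ℕ) → Fin K → Matrix (Fin (p n)) (Fin (p n)) ℂ}
  {B : (n : ℕ) → Fin K → Matrix (Fin n) (Fin n) ℂ}
  (hA : ∀ n r, (A n r).PosSemidef) (hB : ∀ n r, (B n r).PosSemidef)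
  {τ : ℝ} (hτ : 0 ≤ τ)
  (hAτ : ∀ n r, opNorm (A n r) ≤ τ) (hBτ : ∀ n r, opNorm (B n r) ≤ τ)

include hc hp hA hB hτ hAτ hBτ

/-- Asymptotic universality of the expected Stieltjes transform for nearly standard
innovations. -/
theorem tendsto_norm_integral_stieltjes_sub
    {μ ν : (n : ℕ) → Fin K × Fin (p n) × Fin n → Measure ℂ}
    (iμ : ∀ n q, IsProbabilityMeasure (μ n q)) (iν : ∀ n q, IsProbabilityMeasure (ν n q))
    {ε₁ ε₂ L : ℕ → ℝ} (hε₂ : ∀ n, 0 ≤ ε₂ n)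
    (hμ : ∀ᶠ n in atTop, ∀ q, IsNearStandard (μ n q) (ε₁ n) (ε₂ n) (L n))
    (hν : ∀ᶠ n in atTop, ∀ q, IsNearStandard (ν n q) (ε₁ n) (ε₂ n) (L n))
    (h₁ : Tendsto (fun n : ℕ => √n * ε₁ n) atTop (𝓝 0)) (h₂ : Tendsto ε₂ atTop (𝓝 0))
    (hL : Tendsto (fun n : ℕ => L n / √n) atTop (𝓝 0)) {z : ℂ} (hz : 0 < z.im) :
    Tendsto (fun n : ℕ =>
      ‖∫ x, stieltjes (sampleCov (A n) (B n) (toInnovations x)) z ∂Measure.pi (μ n) -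
        ∫ x, stieltjes (sampleCov (A n) (B n) (toInnovations x)) z ∂Measure.pi (ν n)‖)
      atTop (𝓝 0) := by
  obtain ⟨w, hw, hwz⟩ := exists_sqrt_im_pos hz
  set g := w.im⁻¹ with hg
  set D := ((τ * g) ^ 2 + (τ * g ^ 2) ^ 2) / 2 with hD
  have hw0 : 0 < ‖w‖ := norm_pos_iff.2 fun h => by simp [h] at hw
  have hr : Tendsto (fun n : ℕ => 1 / √(n : ℝ)) atTop (𝓝 0) := by
    simp only [one_div]
    exact tendsto_inv_atTop_zero.comp (Real.tendsto_sqrt_atTop.comp tendsto_natCast_atTop_atTop)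
  have hratio : Tendsto (fun n : ℕ => 1 + ((p n : ℝ) / n)⁻¹) atTop (𝓝 (1 + c⁻¹)) :=
    (hp.inv₀ hc.ne').const_add 1
  have hH := tendsto_harmonic_div_atTop K hc hp
  -- This is the finite-`n` bound rewritten, using `(p + n) / (p * n) = (1 + (p / n)⁻¹) / n` and `K
  -- * p * n` replacements divided by `p`.
  have hub : Tendsto (fun n : ℕ => (K * D / ‖w‖) * ((1 + ε₂ n) * (1 + ((p n : ℝ) / n)⁻¹) *
      ((harmonic (K * (p n * n)) : ℝ) / n)) + (K / (2 * ‖w‖)) * (4 * τ * g ^ 2 * (√n * ε₁ n) +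
      4 * τ ^ 2 * g ^ 3 * ε₂ n + 24 * τ ^ 3 * g ^ 4 * ((1 + ε₂ n) * (1 / √n + L n / √n)) +
      24 * τ ^ 3 * g ^ 4 * (L n / √n))) atTop (𝓝 0) := by
    have t1 := (((h₂.const_add 1).mul hratio).mul hH).const_mul (K * D / ‖w‖)
    have t2 := ((((h₁.const_mul (4 * τ * g ^ 2)).add (h₂.const_mul (4 * τ ^ 2 * g ^ 3))).add
      (((h₂.const_add 1).mul (hr.add hL)).const_mul (24 * τ ^ 3 * g ^ 4))).add
      (hL.const_mul (24 * τ ^ 3 * g ^ 4))).const_mul (K / (2 * ‖w‖))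
    simpa using t1.add t2
  refine squeeze_zero' (Eventually.of_forall fun n => norm_nonneg _) ?_ hub
  filter_upwards [hμ, hν, hp.eventually_const_lt hc, eventually_gt_atTop 0] with n hμn hνn hpn hn
  have hn0 : (0 : ℝ) < n := by exact_mod_cast hn
  have hp0 : (0 : ℝ) < p n := by
    by_contra h
    exact absurd hpn (not_lt.2 (div_nonpos_of_nonpos_of_nonneg (not_lt.1 h) hn0.le))
  have := iμ n
  have := iν n
  refine (norm_integral_stieltjes_sub_le (hA n) (hB n) (hAτ n) (hBτ n) hτ (hε₂ n) hμn hνn hz hw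
    hwz).trans (le_of_eq ?_)
  rw [← hg, ← hD]
  have hs : 0 < √(n : ℝ) := Real.sqrt_pos.2 hn0
  have hsn : (n : ℝ) = √(n : ℝ) ^ 2 := (Real.sq_sqrt hn0.le).symm
  generalize (harmonic (K * (p n * n)) : ℝ) = H
  generalize √(n : ℝ) = s at *
  rw [hsn]
  field_simp
  ring

end Asymptotics

theorem continuous_stieltjes_sampleCov {K p n : ℕ} (A : Fin K → Matrix (Fin p) (Fin p) ℂ)
    (B : Fin K → Matrix (Fin n) (Fin n) ℂ) {z : ℂ} (hz : 0 < z.im) :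
    Continuous fun x => stieltjes (sampleCov A B (toInnovations x)) z := by
  obtain ⟨w, hw, hwz⟩ := exists_sqrt_im_pos hz
  simp only [stieltjes_sampleCov_eq A B hz hwz]
  exact ((continuous_resolvMatrix_hermSum _ _ hw).matrix_trace.const_mul _).sub continuous_const

/-! ### Passage to product laws and the main theorem -/

/-- The expected Stieltjes transform with independent innovations as an integral against the
product of their laws. -/
theorem integral_stieltjes_eq_integral_pi {Ω : Type*} [MeasurableSpace Ω] {P : Measure Ω}
    [IsProbabilityMeasure P] {K p n : ℕ} (A : Fin K → Matrix (Fin p) (Fin p) ℂ)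
    (B : Fin K → Matrix (Fin n) (Fin n) ℂ) {z : ℂ} (hz : 0 < z.im)
    {V : Fin K → Ω → Matrix (Fin p) (Fin n) ℂ}
    (hV : ∀ q : Fin K × Fin p × Fin n, AEMeasurable (fun ω => V q.1 ω q.2.1 q.2.2) P)
    (hi : iIndepFun (fun (q : Fin K × Fin p × Fin n) ω => V q.1 ω q.2.1 q.2.2) P) :
    ∫ ω, stieltjes (sampleCov A B fun r => V r ω) z ∂P =
      ∫ x, stieltjes (sampleCov A B (toInnovations x)) z
        ∂Measure.pi fun q => P.map fun ω => V q.1 ω q.2.1 q.2.2 := by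
  have e : ∀ ω, (fun r => V r ω) = toInnovations fun q => V q.1 ω q.2.1 q.2.2 := fun ω => rfl
  simp only [e]
  rw [← (iIndepFun_iff_map_fun_eq_pi_map hV).1 hi,
    integral_map (aemeasurable_pi_lambda _ hV)
      (continuous_stieltjes_sampleCov A B hz).aestronglyMeasurable]

theorem integral_stieltjes_truncate_eq_integral_pi {Ω : Type*} [MeasurableSpace Ω] {P : Measure Ω}
    [IsProbabilityMeasure P] {K p n : ℕ} (A : Fin K → Matrix (Fin p) (Fin p) ℂ)
    (B : Fin K → Matrix (Fin n) (Fin n) ℂ) {z : ℂ} (hz : 0 < z.im)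
    {V : Fin K → Ω → Matrix (Fin p) (Fin n) ℂ}
    (hV : ∀ q : Fin K × Fin p × Fin n, AEMeasurable (fun ω => V q.1 ω q.2.1 q.2.2) P)
    (hi : iIndepFun (fun (q : Fin K × Fin p × Fin n) ω => V q.1 ω q.2.1 q.2.2) P) (b : ℝ) :
    ∫ ω, stieltjes (sampleCov A B fun r => truncate b (V r ω)) z ∂P =
      ∫ x, stieltjes (sampleCov A B (toInnovations x)) z
        ∂Measure.pi fun q => (P.map fun ω => V q.1 ω q.2.1 q.2.2).map (truncAt b) := by
  have hm := measurable_truncAt b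
  have h := integral_stieltjes_eq_integral_pi A B hz (V := fun r ω => truncate b (V r ω))
    (fun q => hm.comp_aemeasurable (hV q)) (hi.comp (fun _ => truncAt b) fun _ => hm)
  rw [h]
  congr 2
  funext q
  exact (AEMeasurable.map_map_of_aemeasurable hm.aemeasurable (hV q)).symm

theorem tendsto_natCast_rpow_neg {s : ℝ} (hs : s < 0) :
    Tendsto (fun n : ℕ => (n : ℝ) ^ s) atTop (𝓝 0) := by
  have := (tendsto_rpow_neg_atTop (y := -s) (by linarith)).comp
    (tendsto_natCast_atTop_atTop (R := ℝ))
  simpa [Function.comp_def] using this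

theorem theorem4p8
    {Ω Ω' : Type*} [MeasurableSpace Ω] [MeasurableSpace Ω']
    (P : Measure Ω) [IsProbabilityMeasure P] (P' : Measure Ω') [IsProbabilityMeasure P']
    (K : ℕ) (p : ℕ → ℕ) (c : ℝ) (hc : 0 < c)
    (hp : Tendsto (fun n : ℕ => (p n : ℝ) / (n : ℝ)) atTop (𝓝 c))
    (A : (n : ℕ) → Fin K → Matrix (Fin (p n)) (Fin (p n)) ℂ)
    (B : (n : ℕ) → Fin K → Matrix (Fin n) (Fin n) ℂ)
    (hA : ∀ n r, (A n r).PosSemidef) (hB : ∀ n r, (B n r).PosSemidef)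
    (τ : ℝ) (hτ : 0 < τ)
    (hAτ : ∀ n r, opNorm (A n r) ≤ τ) (hBτ : ∀ n r, opNorm (B n r) ≤ τ)
    (Z : (n : ℕ) → Fin K → Ω → Matrix (Fin (p n)) (Fin n) ℂ)
    (hZmeas : ∀ n r i j, Measurable fun ω => Z n r ω i j)
    (hZindep : ∀ n, iIndepFun
      (fun (q : Fin K × Fin (p n) × Fin n) (ω : Ω) => Z n q.1 ω q.2.1 q.2.2) P)
    (hZmean : ∀ n r i j, ∫ ω, Z n r ω i j ∂P = 0)
    (hZvar : ∀ n r i j, ∫ ω, ‖Z n r ω i j‖ ^ 2 ∂P = 1)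
    (W : (n : ℕ) → Fin K → Ω' → Matrix (Fin (p n)) (Fin n) ℂ)
    (hWlaw : ∀ n r i j, HasLaw (fun ω => W n r ω i j) stdComplexGaussian P')
    (hWindep : ∀ n, iIndepFun
      (fun (q : Fin K × Fin (p n) × Fin n) (ω : Ω') => W n q.1 ω q.2.1 q.2.2) P')
    (η₀ a : ℝ) (hη₀ : 0 < η₀) (ha : 1 / (4 + η₀) < a) (ha' : a < 1 / 4)
    (z : ℂ) (hz : 0 < z.im) :
    ((∃ M : ℝ, ∀ n r i j, Integrable (fun ω => ‖Z n r ω i j‖ ^ (4 + η₀)) P ∧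
        ∫ ω, ‖Z n r ω i j‖ ^ (4 + η₀) ∂P ≤ M) →
      Tendsto (fun n : ℕ =>
        ‖(∫ ω, stieltjes (sampleCov (A n) (B n)
            fun r => truncate ((n : ℝ) ^ a) (W n r ω)) z ∂P') -
          ∫ ω, stieltjes (sampleCov (A n) (B n)
            fun r => truncate ((n : ℝ) ^ a) (Z n r ω)) z ∂P‖) atTop (𝓝 0) ∧
      Tendsto (fun n : ℕ =>
        ‖(∫ ω, stieltjes (sampleCov (A n) (B n) fun r => W n r ω) z ∂P') -
          ∫ ω, stieltjes (sampleCov (A n) (B n)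
            fun r => truncate ((n : ℝ) ^ a) (Z n r ω)) z ∂P‖) atTop (𝓝 0)) ∧
    ((∀ n r i j, ∀ᵐ ω ∂P, ‖Z n r ω i j‖ ≤ (n : ℝ) ^ a) →
      Tendsto (fun n : ℕ =>
        ‖(∫ ω, stieltjes (sampleCov (A n) (B n)
            fun r => truncate ((n : ℝ) ^ a) (W n r ω)) z ∂P') -
          ∫ ω, stieltjes (sampleCov (A n) (B n) fun r => Z n r ω) z ∂P‖) atTop (𝓝 0) ∧
      Tendsto (fun n : ℕ =>
        ‖(∫ ω, stieltjes (sampleCov (A n) (B n) fun r => W n r ω) z ∂P') -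
          ∫ ω, stieltjes (sampleCov (A n) (B n) fun r => Z n r ω) z ∂P‖) atTop (𝓝 0)) := by
  have ht3 : (3 : ℝ) ≤ 4 + η₀ := by linarith
  have ha0 : 0 < a := lt_trans (by positivity) ha
  have hat : 1 < a * (4 + η₀) := by rwa [div_lt_iff₀ (by positivity)] at ha
  -- Only eventually, because the truncation level is `0` at `n = 0`.
  have hb : ∀ᶠ n : ℕ in atTop, 0 < (n : ℝ) ^ a := by
    filter_upwards [eventually_gt_atTop 0] with n hn
    exact Real.rpow_pos_of_pos (by exact_mod_cast hn) a
  obtain ⟨MW, hMW⟩ : ∃ MW, MW = ∫ h : ℂ, ‖h‖ ^ (4 + η₀) ∂stdComplexGaussian := ⟨_, rfl⟩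
  have hMW0 : 0 ≤ MW := by
    rw [hMW]
    exact integral_nonneg fun h => by positivity
  have hWi : Integrable (fun h : ℂ => ‖h‖ ^ (4 + η₀)) stdComplexGaussian :=
    integrable_rpow_stdComplexGaussian (by positivity)
  have hG := isStandardLaw_stdComplexGaussian
  -- the error sequences for a moment bound `M`
  have lim₁ : ∀ M : ℝ, Tendsto (fun n : ℕ => √(n : ℝ) * (M * ((n : ℝ) ^ a) ^ (1 - (4 + η₀))))
      atTop (𝓝 0) := by
    intro M
    -- The exponent is `1/2 + a - a * (4 + η₀) < 1/2 + 1/4 - 1 < 0`.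
    have h := (tendsto_natCast_rpow_neg (s := 1 / 2 + a * (1 - (4 + η₀)))
      (by nlinarith)).const_mul M
    rw [mul_zero] at h
    refine h.congr' ?_
    filter_upwards [eventually_gt_atTop 0] with n hn
    have hn0 : (0 : ℝ) < n := by exact_mod_cast hn
    rw [Real.rpow_add hn0, Real.rpow_mul hn0.le, Real.sqrt_eq_rpow]
    ring
  have lim₂ : ∀ M : ℝ, Tendsto (fun n : ℕ => M * ((n : ℝ) ^ a) ^ (2 - (4 + η₀)))
      atTop (𝓝 0) := by
    intro M
    have h := (tendsto_natCast_rpow_neg (s := a * (2 - (4 + η₀))) (by nlinarith)).const_mul M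
    rw [mul_zero] at h
    refine h.congr fun n => ?_
    rw [Real.rpow_mul (Nat.cast_nonneg n)]
  -- The third-moment bound `1 + M + n ^ a` covers both the moment case (`1 + M`) and the bounded
  -- case (`n ^ a`), so one error triple serves all four limits.
  have lim₃ : ∀ M : ℝ, Tendsto (fun n : ℕ => (1 + M + (n : ℝ) ^ a) / √(n : ℝ)) atTop (𝓝 0) := by
    intro M
    have h := ((tendsto_natCast_rpow_neg (s := -(1 / 2)) (by norm_num)).const_mul (1 + M)).add
      (tendsto_natCast_rpow_neg (s := a - 1 / 2) (by linarith))
    rw [mul_zero, add_zero] at h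
    refine h.congr' ?_
    filter_upwards [eventually_gt_atTop 0] with n hn
    have hn0 : (0 : ℝ) < n := by exact_mod_cast hn
    rw [Real.rpow_sub hn0, Real.rpow_neg hn0.le, Real.sqrt_eq_rpow]
    ring
  have hZae : ∀ n (q : Fin K × Fin (p n) × Fin n),
      AEMeasurable (fun ω => Z n q.1 ω q.2.1 q.2.2) P := fun n q =>
    (hZmeas n q.1 q.2.1 q.2.2).aemeasurable
  have hWae : ∀ n (q : Fin K × Fin (p n) × Fin n),
      AEMeasurable (fun ω => W n q.1 ω q.2.1 q.2.2) P' := fun n q =>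
    (hWlaw n q.1 q.2.1 q.2.2).aemeasurable
  have hWmap : ∀ n (q : Fin K × Fin (p n) × Fin n),
      P'.map (fun ω => W n q.1 ω q.2.1 q.2.2) = stdComplexGaussian := fun n q =>
    (hWlaw n q.1 q.2.1 q.2.2).map_eq
  have iZ : ∀ n (q : Fin K × Fin (p n) × Fin n),
      IsProbabilityMeasure (P.map fun ω => Z n q.1 ω q.2.1 q.2.2) := fun n q =>
    Measure.isProbabilityMeasure_map (hZae n q)
  have hZs : ∀ n (q : Fin K × Fin (p n) × Fin n),
      IsStandardLaw (P.map fun ω => Z n q.1 ω q.2.1 q.2.2) := fun n q =>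
    ⟨by rw [integral_map (hZae n q) (by fun_prop)]; exact hZmean _ _ _ _,
      by rw [integral_map (hZae n q) (by fun_prop)]; exact hZvar _ _ _ _⟩
  have eW : ∀ n, ∫ ω, stieltjes (sampleCov (A n) (B n) fun r => W n r ω) z ∂P' =
      ∫ x, stieltjes (sampleCov (A n) (B n) (toInnovations x)) z
        ∂Measure.pi fun _ => stdComplexGaussian := fun n => by
    have h := integral_stieltjes_eq_integral_pi (A n) (B n) hz (hWae n) (hWindep n)
    simp only [hWmap n] at h
    exact h
  have eWt : ∀ n, ∫ ω, stieltjes (sampleCov (A n) (B n)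
        fun r => truncate ((n : ℝ) ^ a) (W n r ω)) z ∂P' =
      ∫ x, stieltjes (sampleCov (A n) (B n) (toInnovations x)) z
        ∂Measure.pi fun _ => stdComplexGaussian.map (truncAt ((n : ℝ) ^ a)) := fun n => by
    have h := integral_stieltjes_truncate_eq_integral_pi (A n) (B n) hz (hWae n) (hWindep n)
      ((n : ℝ) ^ a)
    simp only [hWmap n] at h
    exact h
  have eZ : ∀ n, ∫ ω, stieltjes (sampleCov (A n) (B n) fun r => Z n r ω) z ∂P =
      ∫ x, stieltjes (sampleCov (A n) (B n) (toInnovations x)) z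
        ∂Measure.pi fun q => P.map fun ω => Z n q.1 ω q.2.1 q.2.2 := fun n =>
    integral_stieltjes_eq_integral_pi (A n) (B n) hz (hZae n) (hZindep n)
  have eZt : ∀ n, ∫ ω, stieltjes (sampleCov (A n) (B n)
        fun r => truncate ((n : ℝ) ^ a) (Z n r ω)) z ∂P =
      ∫ x, stieltjes (sampleCov (A n) (B n) (toInnovations x)) z
        ∂Measure.pi fun q => (P.map fun ω => Z n q.1 ω q.2.1 q.2.2).map
          (truncAt ((n : ℝ) ^ a)) := fun n =>
    integral_stieltjes_truncate_eq_integral_pi (A n) (B n) hz (hZae n) (hZindep n) ((n : ℝ) ^ a)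
  have iT : ∀ (μ : Measure ℂ) [IsProbabilityMeasure μ] (b : ℝ),
      IsProbabilityMeasure (μ.map (truncAt b)) := fun μ _ b =>
    Measure.isProbabilityMeasure_map (measurable_truncAt b).aemeasurable
  have hGn : ∀ M, MW ≤ M → ∀ᶠ n : ℕ in atTop, ∀ _q : Fin K × Fin (p n) × Fin n,
      IsNearStandard stdComplexGaussian (M * ((n : ℝ) ^ a) ^ (1 - (4 + η₀)))
        (M * ((n : ℝ) ^ a) ^ (2 - (4 + η₀))) (1 + M + (n : ℝ) ^ a) := fun M hM => by
    have hM0 := hMW0.trans hM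
    refine Eventually.of_forall fun n q => (hG.isNearStandard ht3 hWi (hMW.ge.trans hM)).mono
      (by positivity) (by positivity) ?_
    linarith [Real.rpow_nonneg (Nat.cast_nonneg (α := ℝ) n) a]
  have hTn : ∀ M, ∀ μ : (n : ℕ) → Fin K × Fin (p n) × Fin n → Measure ℂ,
      (∀ n q, IsProbabilityMeasure (μ n q)) → (∀ n q, IsStandardLaw (μ n q)) →
      (∀ n q, Integrable (fun h : ℂ => ‖h‖ ^ (4 + η₀)) (μ n q)) →
      (∀ n q, ∫ h : ℂ, ‖h‖ ^ (4 + η₀) ∂(μ n q) ≤ M) →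
      ∀ᶠ n : ℕ in atTop, ∀ q : Fin K × Fin (p n) × Fin n,
      IsNearStandard ((μ n q).map (truncAt ((n : ℝ) ^ a)))
        (M * ((n : ℝ) ^ a) ^ (1 - (4 + η₀)))
        (M * ((n : ℝ) ^ a) ^ (2 - (4 + η₀))) (1 + M + (n : ℝ) ^ a) := by
    intro M μ i1 h1 h2 h3
    filter_upwards [hb] with n hbn q
    have := i1 n q
    exact ((h1 n q).isNearStandard_map_truncAt ht3 hbn (h2 n q) (h3 n q)).mono le_rfl le_rfl
      (by linarith)
  have concl : ∀ M, 0 ≤ M → ∀ μ ν : (n : ℕ) → Fin K × Fin (p n) × Fin n → Measure ℂ,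
      (∀ n q, IsProbabilityMeasure (μ n q)) → (∀ n q, IsProbabilityMeasure (ν n q)) →
      (∀ᶠ n : ℕ in atTop, ∀ q, IsNearStandard (μ n q) (M * ((n : ℝ) ^ a) ^ (1 - (4 + η₀)))
        (M * ((n : ℝ) ^ a) ^ (2 - (4 + η₀))) (1 + M + (n : ℝ) ^ a)) →
      (∀ᶠ n : ℕ in atTop, ∀ q, IsNearStandard (ν n q) (M * ((n : ℝ) ^ a) ^ (1 - (4 + η₀)))
        (M * ((n : ℝ) ^ a) ^ (2 - (4 + η₀))) (1 + M + (n : ℝ) ^ a)) →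
      Tendsto (fun n : ℕ =>
        ‖∫ x, stieltjes (sampleCov (A n) (B n) (toInnovations x)) z ∂Measure.pi (μ n) -
          ∫ x, stieltjes (sampleCov (A n) (B n) (toInnovations x)) z ∂Measure.pi (ν n)‖)
        atTop (𝓝 0) := fun M hM μ ν i1 i2 h1 h2 =>
    tendsto_norm_integral_stieltjes_sub hc hp hA hB hτ.le hAτ hBτ i1 i2
      (fun n => by positivity) h1 h2 (lim₁ M) (lim₂ M) (lim₃ M) hz
  constructor
  · rintro ⟨M, hM⟩
    -- `|M| + MW` is a nonnegative bound common to the given entries and the Gaussian ones.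
    have hM' : ∀ n (q : Fin K × Fin (p n) × Fin n),
        ∫ h : ℂ, ‖h‖ ^ (4 + η₀) ∂(P.map fun ω => Z n q.1 ω q.2.1 q.2.2) ≤ |M| + MW := fun n q => by
      rw [integral_map (hZae n q) (measurable_norm.pow_const _).aestronglyMeasurable]
      linarith [(hM n q.1 q.2.1 q.2.2).2, le_abs_self M]
    have hMi : ∀ n (q : Fin K × Fin (p n) × Fin n), Integrable (fun h : ℂ => ‖h‖ ^ (4 + η₀))
        (P.map fun ω => Z n q.1 ω q.2.1 q.2.2) := fun n q =>
      (integrable_map_measure (measurable_norm.pow_const _).aestronglyMeasurable (hZae n q)).2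
        (hM n q.1 q.2.1 q.2.2).1
    have hMW' : MW ≤ |M| + MW := le_add_of_nonneg_left (abs_nonneg M)
    have hZn := hTn (|M| + MW) _ iZ hZs hMi hM'
    simp only [eW, eWt, eZt]
    exact ⟨concl (|M| + MW) (by positivity) _ _ (fun n q => iT _ _)
        (fun n q => have := iZ n q; iT _ _)
        (hTn (|M| + MW) (fun _ _ => stdComplexGaussian) (fun _ _ => inferInstance)
          (fun _ _ => hG) (fun _ _ => hWi) fun _ _ => hMW.ge.trans hMW') hZn,
      concl (|M| + MW) (by positivity) _ _ (fun n q => inferInstance)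
        (fun n q => have := iZ n q; iT _ _) (hGn _ hMW') hZn⟩
  · intro hbd
    have hZn : ∀ᶠ n : ℕ in atTop, ∀ q : Fin K × Fin (p n) × Fin n,
        IsNearStandard (P.map fun ω => Z n q.1 ω q.2.1 q.2.2)
          (MW * ((n : ℝ) ^ a) ^ (1 - (4 + η₀)))
          (MW * ((n : ℝ) ^ a) ^ (2 - (4 + η₀))) (1 + MW + (n : ℝ) ^ a) := by
      -- The untruncated bounded entries have no mean or variance error, so the Gaussian constant
      -- `MW` alone fixes the error triple.
      refine Eventually.of_forall fun n q => ((hZs n q).isNearStandard_of_bounded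
        (b := (n : ℝ) ^ a) ?_).mono (by positivity) (by positivity) (by linarith)
      rw [ae_map_iff (hZae n q) (measurableSet_le measurable_norm measurable_const)]
      exact hbd n q.1 q.2.1 q.2.2
    simp only [eW, eWt, eZ]
    exact ⟨concl MW hMW0 _ _ (fun n q => iT _ _) iZ
        (hTn MW (fun _ _ => stdComplexGaussian) (fun _ _ => inferInstance)
          (fun _ _ => hG) (fun _ _ => hWi) fun _ _ => hMW.ge) hZn,
      concl MW hMW0 _ _ (fun n q => inferInstance) iZ (hGn _ le_rfl) hZn⟩
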